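/- Let $\mathbb{M}$ be a Hadamard surface, that is, a complete simply connected smooth Riemannian surface of nonpositive curvature, and suppose that its Gauss curvature satisfies $-k_1^2 < K_{\mathbb{M}} < -k_2^2$ at every point, where $k_1, k_2 > 0$ are constants. Fix global geodesic polar coordinates $(s,\theta)$ on $\mathbb{M}$ around a point $p$: the point with coordinates $(s,\theta)$ is $\exp_p(s\cos\theta\, e_1 + s\sin\theta\, e_2)$ for an orthonormal basis $e_1, e_2$ of $T_p\mathbb{M}$, and $(s\cos\theta, s\sin\theta)$ defines a global diffeomorphism between $\mathbb{R}^2$ and $\mathbb{M}$. For $A, k > 0$ let $R_{A,k} = \operatorname{arcsinh}(A)/k$, let $$h_{A,k}(s) = \int_{R_{A,k}}^{s} \frac{A}{\sqrt{\sinh^2(kr) - A^2}}\,dr \qquad (s \ge R_{A,k}),$$ and consider in the Riemannian product $\mathbb{M} \times \mathbb{R}$ the rotational annulus $$C_{\mathbb{M}}^{A,k} = \{(s,\theta,(-1)^j h_{A,k}(s)) : s \ge R_{A,k},\ \theta\in\mathbb{R},\ j \in \{0,1\}\}.$$ It separates $\mathbb{M} \times \mathbb{R}$ into two components. The one that contains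 $\mathbb{M} \times (T, +\infty)$ for some $T \in \mathbb{R}$ is called the inner region, the other one the outer region. The mean curvature vector field of $C_{\mathbb{M}}^{A,k}$ is said to point inwards (resp. outwards) if it is nonzero at every point of the annulus, including the neck $s = R_{A,k}$, and points there to the inner (resp. outer) region. Then, for every $A > 0$, the mean curvature vector field of $C_{\mathbb{M}}^{A,k_1}$ points outwards, and the mean curvature vector field of $C_{\mathbb{M}}^{A,k_2}$ points inwards. -/

import Mathlib

open Set Filter Topology Manifold Bundle
open scoped ContDiff

/-! ### Riemannian geometry in coordinates

`g : E → E →L[ℝ] E →L[ℝ] ℝ` is a Riemannian metric on (an open part of) a finite-dimensional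
coordinate space `E`: `g y u v` is the scalar product of the vectors `u`, `v` at `y`. -/

noncomputable section

namespace CoordMetric

variable {E : Type*} [NormedAddCommGroup E] [NormedSpace ℝ E]

/-- The Christoffel symbols `Γ_y(u, v) ∈ E` of the Levi-Civita connection of `g`, that is, the
solution of `g(Γ(u, v), w) = ½ (∂_u g(v, w) + ∂_v g(u, w) - ∂_w g(u, v))` for all `w`.
For constant fields `u`, `v` one has `∇_u v = Γ(u, v)`. -/
def christoffel (g : E → E →L[ℝ] E →L[ℝ] ℝ) (y u v : E) : E :=
  (g y).inverse ((1 / 2 : ℝ) •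
    (fderiv ℝ g y u v + fderiv ℝ g y v u - ((fderiv ℝ g y).flip u).flip v))

/-- The curvature tensor `R(u, v) w = ∇_u ∇_v w - ∇_v ∇_u w` (for constant fields). -/
def curvatureTensor (g : E → E →L[ℝ] E →L[ℝ] ℝ) (y u v w : E) : E :=
  fderiv ℝ (fun y' => christoffel g y' v w) y u - fderiv ℝ (fun y' => christoffel g y' u w) y v
    + christoffel g y u (christoffel g y v w) - christoffel g y v (christoffel g y u w)

/-- The sectional curvature of the plane spanned by `u` and `v`. -/
def sectionalCurvature (g : E → E →L[ℝ] E →L[ℝ] ℝ) (y u v : E) : ℝ :=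
  g y (curvatureTensor g y u v v) u / (g y u u * g y v v - g y u v ^ 2)

/-- The product metric `g + dt²` on `E × ℝ`. -/
def prodLine (g : E → E →L[ℝ] E →L[ℝ] ℝ) (x : E × ℝ) : (E × ℝ) →L[ℝ] (E × ℝ) →L[ℝ] ℝ :=
  (g x.1).bilinearComp (ContinuousLinearMap.fst ℝ E ℝ) (ContinuousLinearMap.fst ℝ E ℝ) +
    (ContinuousLinearMap.mul ℝ ℝ).bilinearComp (ContinuousLinearMap.snd ℝ E ℝ)
      (ContinuousLinearMap.snd ℝ E ℝ)

/-- The coordinate field `∂_i X` of a parametrized surface `X` with parameters in `ℝ²`. -/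
def tangentField (X : EuclideanSpace ℝ (Fin 2) → E) (i : Fin 2)
    (w : EuclideanSpace ℝ (Fin 2)) : E :=
  fderiv ℝ X w (EuclideanSpace.single i 1)

/-- The first fundamental form `a_{ij} = g(∂_i X, ∂_j X)`. -/
def firstForm (g : E → E →L[ℝ] E →L[ℝ] ℝ) (X : EuclideanSpace ℝ (Fin 2) → E)
    (w : EuclideanSpace ℝ (Fin 2)) : Matrix (Fin 2) (Fin 2) ℝ :=
  Matrix.of fun i j => g (X w) (tangentField X i w) (tangentField X j w)

/-- The component of `v` normal to the surface `X`: `v - ∑ a^{ij} g(v, ∂_i X) ∂_j X`. -/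
def normalPart (g : E → E →L[ℝ] E →L[ℝ] ℝ) (X : EuclideanSpace ℝ (Fin 2) → E)
    (w : EuclideanSpace ℝ (Fin 2)) (v : E) : E :=
  v - ∑ i, ∑ j, ((firstForm g X w)⁻¹ i j * g (X w) v (tangentField X i w)) • tangentField X j w

/-- The second fundamental form
`II(∂_i, ∂_j) = (∇_{∂_i X} ∂_j X)^⊥ = (∂_i ∂_j X + Γ(∂_i X, ∂_j X))^⊥`. -/
def secondForm (g : E → E →L[ℝ] E →L[ℝ] ℝ) (X : EuclideanSpace ℝ (Fin 2) → E)
    (w : EuclideanSpace ℝ (Fin 2)) (i j : Fin 2) : E :=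
  normalPart g X w
    (fderiv ℝ (tangentField X j) w (EuclideanSpace.single i 1)
      + christoffel g (X w) (tangentField X i w) (tangentField X j w))

/-- The mean curvature vector `H = ½ ∑ a^{ij} II(∂_i, ∂_j)`. -/
def meanCurvatureVector (g : E → E →L[ℝ] E →L[ℝ] ℝ) (X : EuclideanSpace ℝ (Fin 2) → E)
    (w : EuclideanSpace ℝ (Fin 2)) : E :=
  (1 / 2 : ℝ) • ∑ i, ∑ j, (firstForm g X w)⁻¹ i j • secondForm g X w i j

end CoordMetric

/-! ### Surfaces -/

namespace RiemannianSurface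

/-- The plane on which surfaces are modelled. -/
abbrev Plane : Type := EuclideanSpace ℝ (Fin 2)

/-- The model with corners of `M × ℝ`, for a surface `M`. -/
abbrev prodModel : ModelWithCorners ℝ (Plane × ℝ) (ModelProd Plane ℝ) :=
  𝓘(ℝ, Plane).prod 𝓘(ℝ, ℝ)

section

variable {M : Type*} [MetricSpace M] [ChartedSpace Plane M]
  [RiemannianBundle (fun x : M => TangentSpace 𝓘(ℝ, Plane) x)]

/-- The Riemannian metric of `M` in the chart `φ`: `u, v ↦ ⟨dφ⁻¹ u, dφ⁻¹ v⟩`. -/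
def chartMetric (φ : OpenPartialHomeomorph M Plane) (y : Plane) :
    Plane →L[ℝ] Plane →L[ℝ] ℝ :=
  LinearMap.toContinuousBilinearMap
    (LinearMap.mk₂ ℝ
      (fun u v : Plane =>
        inner ℝ (mfderiv 𝓘(ℝ, Plane) 𝓘(ℝ, Plane) φ.symm y u)
          (mfderiv 𝓘(ℝ, Plane) 𝓘(ℝ, Plane) φ.symm y v))
      (fun u u' v => by
        rw [← inner_add_left]; exact congrArg (inner ℝ · _) (map_add _ u u'))
      (fun c u v => by
        rw [smul_eq_mul, ← real_inner_smul_left]; exact congrArg (inner ℝ · _) (map_smul _ c u))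
      (fun u v v' => by
        rw [← inner_add_right]; exact congrArg (inner ℝ _) (map_add _ v v'))
      (fun c u v => by
        rw [smul_eq_mul, ← real_inner_smul_right]; exact congrArg (inner ℝ _) (map_smul _ c v)))

/-- The Gauss curvature of `M` at `q`, computed in a chart `φ` of the smooth structure around `q`
(it does not depend on the chart). -/
def gaussCurvature (φ : OpenPartialHomeomorph M Plane) (q : M) : ℝ :=
  CoordMetric.sectionalCurvature (chartMetric φ) (φ q)
    (EuclideanSpace.single 0 1) (EuclideanSpace.single 1 1)

/-- A property of real numbers holds for the Gauss curvature of `M` at every point. -/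
def GaussCurvatureSatisfies (M : Type*) [MetricSpace M] [ChartedSpace Plane M]
    [RiemannianBundle (fun x : M => TangentSpace 𝓘(ℝ, Plane) x)] (P : ℝ → Prop) : Prop :=
  ∀ φ ∈ IsManifold.maximalAtlas 𝓘(ℝ, Plane) ∞ M, ∀ q ∈ φ.source, P (gaussCurvature φ q)

/-- A Hadamard surface: complete, simply connected, of nonpositive curvature. -/
structure IsHadamardSurface (M : Type*) [MetricSpace M] [ChartedSpace Plane M]
    [RiemannianBundle (fun x : M => TangentSpace 𝓘(ℝ, Plane) x)] : Prop where
  complete : CompleteSpace M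
  simplyConnected : SimplyConnectedSpace M
  nonpositive : GaussCurvatureSatisfies M (· ≤ 0)

/-- `c : ℝ → M` is a (complete, affinely parametrized) geodesic: `c'' + Γ(c', c') = 0` in the
charts of `M`. -/
def IsGeodesic (c : ℝ → M) : Prop :=
  ContMDiff 𝓘(ℝ, ℝ) 𝓘(ℝ, Plane) ∞ c ∧
    ∀ φ ∈ IsManifold.maximalAtlas 𝓘(ℝ, Plane) ∞ M, ∀ t : ℝ, c t ∈ φ.source →
      deriv (deriv fun τ => φ (c τ)) t
        + CoordMetric.christoffel (chartMetric φ) (φ (c t))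
            (deriv (fun τ => φ (c τ)) t) (deriv (fun τ => φ (c τ)) t) = 0

/-- The point of the plane with polar coordinates `(s, θ)`. -/
def polar (s θ : ℝ) : Plane := !₂[s * Real.cos θ, s * Real.sin θ]

/-- `(s, θ) ↦ F (s cos θ, s sin θ)` is a geodesic polar coordinate system on `M` around the pole
`F 0`: `F` is `exp ∘ L` for the exponential map at `F 0` and a linear isometry `L` from `ℝ²` to
the tangent space there. -/
structure IsGeodesicPolar (F : Plane ≃ₘ⟮𝓘(ℝ, Plane), 𝓘(ℝ, Plane)⟯ M) : Prop where
  isometric_at_pole : ∀ v : Plane, ‖mfderiv 𝓘(ℝ, Plane) 𝓘(ℝ, Plane) F 0 v‖ = ‖v‖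
  geodesic_rays : ∀ θ : ℝ, IsGeodesic fun s => F (polar s θ)

/-! ### Surfaces in `M × ℝ` -/

/-- `X` is a smooth local parametrization at `0` of the set `S ⊆ M × ℝ` around its point `x`,
which makes `S` an embedded surface near `x`. -/
structure IsLocalParametrization (S : Set (M × ℝ)) (x : M × ℝ) (X : Plane → M × ℝ) : Prop where
  base : X 0 = x
  smooth : ∀ᶠ w in 𝓝 0, ContMDiffAt 𝓘(ℝ, Plane) prodModel ∞ X w
  immersive : Function.Injective (mfderiv 𝓘(ℝ, Plane) prodModel X 0)
  map_nhds : Filter.map X (𝓝 0) = 𝓝[S] x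

/-- The set `S ⊆ M × ℝ` is an embedded surface near `x`, and `H` is its mean curvature vector
there with respect to the product metric. The vector is computed in a local parametrization of
`S` and a chart of `M` (it depends on neither). -/
def HasMeanCurvatureVector (S : Set (M × ℝ)) (x : M × ℝ) (H : TangentSpace prodModel x) : Prop :=
  ∃ X : Plane → M × ℝ, IsLocalParametrization S x X ∧
    ∃ φ ∈ IsManifold.maximalAtlas 𝓘(ℝ, Plane) ∞ M, x.1 ∈ φ.source ∧
      ∃ V : Plane × ℝ,
        V = CoordMetric.meanCurvatureVector (CoordMetric.prodLine (chartMetric φ))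
          (fun w => (φ (X w).1, (X w).2)) 0 ∧
        H = ((mfderiv 𝓘(ℝ, Plane) 𝓘(ℝ, Plane) φ.symm (φ x.1) V.1, V.2) : Plane × ℝ)

/-- The tangent vector `H` at `x` points into the set `Ω`: every curve that leaves `x` with
velocity `H` enters `Ω` at once. -/
def PointsInto (Ω : Set (M × ℝ)) (x : M × ℝ) (H : TangentSpace prodModel x) : Prop :=
  ∀ c : ℝ → M × ℝ, c 0 = x → MDifferentiableAt 𝓘(ℝ, ℝ) prodModel c 0 →
    mfderiv 𝓘(ℝ, ℝ) prodModel c 0 (1 : ℝ) = H → ∀ᶠ t in 𝓝[>] (0 : ℝ), c t ∈ Ω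

/-- The union of the components of `Sᶜ` that contain `M × (T, ∞)` for some `T`. -/
def innerRegion (S : Set (M × ℝ)) : Set (M × ℝ) :=
  {x | x ∈ Sᶜ ∧ ∃ T : ℝ, univ ×ˢ Ioi T ⊆ connectedComponentIn Sᶜ x}

/-- The rest of the complement of `S`. -/
def outerRegion (S : Set (M × ℝ)) : Set (M × ℝ) :=
  {x | x ∈ Sᶜ ∧ x ∉ innerRegion S}

/-- At each point of `S` the mean curvature vector exists, is nonzero and points into the inner
region. -/
def MeanCurvaturePointsInwards (S : Set (M × ℝ)) : Prop :=
  ∀ x ∈ S, ∃ H : TangentSpace prodModel x,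
    HasMeanCurvatureVector S x H ∧ H ≠ 0 ∧ PointsInto (innerRegion S) x H

/-- At each point of `S` the mean curvature vector exists, is nonzero and points into the outer
region. -/
def MeanCurvaturePointsOutwards (S : Set (M × ℝ)) : Prop :=
  ∀ x ∈ S, ∃ H : TangentSpace prodModel x,
    HasMeanCurvatureVector S x H ∧ H ≠ 0 ∧ PointsInto (outerRegion S) x H

/-! ### Catenoids -/

/-- The neck radius `R_{A,k}`. -/
def neckRadius (A k : ℝ) : ℝ := Real.arsinh A / k

/-- The profile `h_{A,k}` of the rotational catenoid of `ℍ²(-k²) × ℝ`, for `s ≥ R_{A,k}`. -/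
def profile (A k s : ℝ) : ℝ :=
  ∫ r in (neckRadius A k)..s, A / Real.sqrt (Real.sinh (k * r) ^ 2 - A ^ 2)

/-- The annulus `{(s, θ, ± h_{A,k}(s)) : s ≥ R_{A,k}}` in `M × ℝ`, in the polar coordinates
given by `F`. -/
def catenoid (F : Plane ≃ₘ⟮𝓘(ℝ, Plane), 𝓘(ℝ, Plane)⟯ M) (A k : ℝ) : Set (M × ℝ) :=
  {x | ∃ s θ : ℝ, neckRadius A k ≤ s ∧ ∃ j : Fin 2,
    x = (F (polar s θ), (-1) ^ (j : ℕ) * profile A k s)}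

end

end RiemannianSurface

end

/-! In geodesic polar coordinates the Gauss lemma gives the metric the form `ds² + f² dθ²`, and the
Jacobi equation reads `f'' = -K f`, with `f = 0` at the pole. The annulus is rotationally symmetric
only as a set in these coordinates, since `f` may depend on `θ`. Its mean curvature at a point
nevertheless involves the metric only through `f'/f` at that point.

The profile `h` has a vertical tangent at the neck, so the two halves are replaced by one smooth
meridian, given by `sinh (k s) = A cosh u` with `u` in `ℝ`. Its height `z` satisfies `z' > 0` and
`s' = sinh u * z'`. Along this meridian the mean curvature vector `V`, paired with the conormal
`sinh u dt - ds` that is positive towards the axis, equals `(f'/f - k coth (k s)) / 2`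
(`exists_hasMeanCurvatureVector`). It would vanish for curvature exactly `-k²`, where the annulus is
the minimal catenoid.

The sign is decided by Sturm comparison with `sinh (k s)`. If `K > -k₁²` then `f'/f < k₁ coth (k₁
s)`, and if `K < -k₂²` then `f'/f > k₂ coth (k₂ s)` (`logDeriv_lt_of_curvature`,
`lt_logDeriv_of_curvature`). The inequalities are strict for every `s > 0`, so the vector never
vanishes, not even at the neck.

The sign is then matched with the topological regions. The complement of the annulus is the disjoint
union of the open sets `inside` and `outside`. The first is connected and, as the height is bounded,
contains a half space `M × (T, ∞)`. Hence `inside` lies in the inner region and `outside` in the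
outer one, and a first variation of `s(ι(t)) - s` along curves, with `ι` a local inverse of the
height, shows which side `V` points to. -/

noncomputable section

local notation "Pl" => EuclideanSpace ℝ (Fin 2)
local notation "e₀" => (EuclideanSpace.single (0 : Fin 2) (1 : ℝ) : EuclideanSpace ℝ (Fin 2))
local notation "e₁" => (EuclideanSpace.single (1 : Fin 2) (1 : ℝ) : EuclideanSpace ℝ (Fin 2))

namespace CoordMetric

/-! ### Levi-Civita connection of a nondegenerate metric and of its product with a line. -/

section General

variable {E : Type*} [NormedAddCommGroup E] [NormedSpace ℝ E]

/-- `christoffel` is defined through `ContinuousLinearMap.inverse`, which is zero on non-invertible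
maps. In finite dimension nondegeneracy excludes this default value, because a space and its dual
have the same dimension. -/
theorem isInvertible_of_nondegenerate [FiniteDimensional ℝ E] {B : E →L[ℝ] E →L[ℝ] ℝ}
    (hB : ∀ u, B u = 0 → u = 0) : B.IsInvertible := by
  have hinj : Function.Injective (B : E →ₗ[ℝ] E →L[ℝ] ℝ) :=
    (injective_iff_map_eq_zero _).2 hB
  have hdim : Module.finrank ℝ E = Module.finrank ℝ (E →L[ℝ] ℝ) := by
    rw [← (LinearMap.toContinuousLinearMap (𝕜 := ℝ) (E := E) (F' := ℝ)).finrank_eq]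
    exact (Subspace.dual_finrank_eq (K := ℝ) (V := E)).symm
  exact ⟨(LinearEquiv.ofInjectiveOfFinrankEq (B : E →ₗ[ℝ] E →L[ℝ] ℝ) hinj hdim).toContinuousLinearEquiv,
    by ext; rfl⟩

theorem christoffel_spec [FiniteDimensional ℝ E] {g : E → E →L[ℝ] E →L[ℝ] ℝ} {y : E}
    (hg : ∀ u, g y u = 0 → u = 0) (u v w : E) :
    g y (christoffel g y u v) w =
      (1 / 2) * (fderiv ℝ g y u v w + fderiv ℝ g y v u w - fderiv ℝ g y w u v) := by
  simp [christoffel, (isInvertible_of_nondegenerate hg).self_apply_inverse]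

theorem christoffel_eq [FiniteDimensional ℝ E] {g : E → E →L[ℝ] E →L[ℝ] ℝ} {y : E}
    (hg : ∀ u, g y u = 0 → u = 0) {u v x : E}
    (h : ∀ w, g y x w =
      (1 / 2) * (fderiv ℝ g y u v w + fderiv ℝ g y v u w - fderiv ℝ g y w u v)) :
    christoffel g y u v = x := by
  rw [← sub_eq_zero]
  apply hg
  ext w
  simp [christoffel_spec hg, h]

theorem fderiv_metric_apply {F : Type*} [NormedAddCommGroup F] [NormedSpace ℝ F]
    {g : F → E →L[ℝ] E →L[ℝ] ℝ} {y : F}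
    (hg : DifferentiableAt ℝ g y) (u : F) (v w : E) :
    fderiv ℝ g y u v w = fderiv ℝ (fun y' => g y' v w) y u := by
  have h := (hg.hasFDerivAt.clm_apply (hasFDerivAt_const v y)).clm_apply (hasFDerivAt_const w y)
  rw [h.fderiv (𝕜 := ℝ)]
  simp

theorem differentiableAt_comp_fst {F : Type*} [NormedAddCommGroup F] [NormedSpace ℝ F]
    {f : E → F} {x : E × ℝ} (hf : DifferentiableAt ℝ f x.1) :
    DifferentiableAt ℝ (fun x : E × ℝ => f x.1) x :=
  DifferentiableAt.comp x hf differentiableAt_fst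

theorem differentiableAt_conj_add {A B C D : Type*} [NormedAddCommGroup A] [NormedSpace ℝ A]
    [NormedAddCommGroup B] [NormedSpace ℝ B] [NormedAddCommGroup C] [NormedSpace ℝ C]
    [NormedAddCommGroup D] [NormedSpace ℝ D] {f : E → A →L[ℝ] B} {x : E}
    (hf : DifferentiableAt ℝ f x) (c : B →L[ℝ] D) (d : C →L[ℝ] A) (k : C →L[ℝ] D) :
    DifferentiableAt ℝ (fun x => (c.comp (f x)).comp d + k) x :=
  (((differentiableAt_const _).clm_comp hf).clm_comp (differentiableAt_const _)).add_const k

theorem prodLine_apply (g : E → E →L[ℝ] E →L[ℝ] ℝ) (x u v : E × ℝ) :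
    prodLine g x u v = g x.1 u.1 v.1 + u.2 * v.2 := by
  simp [prodLine]

set_option synthInstance.maxHeartbeats 200000 in
theorem fderiv_prodLine_apply {g : E → E →L[ℝ] E →L[ℝ] ℝ} {x : E × ℝ}
    (hg : DifferentiableAt ℝ g x.1) (u v w : E × ℝ) :
    fderiv ℝ (prodLine g) x u v w = fderiv ℝ g x.1 u.1 v.1 w.1 := by
  have hg' : DifferentiableAt ℝ (fun x : E × ℝ => g x.1) x :=
    differentiableAt_comp_fst (F := E →L[ℝ] E →L[ℝ] ℝ) hg
  have hd : DifferentiableAt ℝ (prodLine g) x := by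
    have h : prodLine g = fun x : E × ℝ =>
        (((ContinuousLinearMap.fst ℝ E ℝ).precomp ℝ).comp (g x.1)).comp
          (ContinuousLinearMap.fst ℝ E ℝ) +
        (ContinuousLinearMap.mul ℝ ℝ).bilinearComp (ContinuousLinearMap.snd ℝ E ℝ)
          (ContinuousLinearMap.snd ℝ E ℝ) := by
      ext x u v <;> simp [prodLine]
    rw [h]
    exact differentiableAt_conj_add (A := E) (B := E →L[ℝ] ℝ) (C := E × ℝ) (D := (E × ℝ) →L[ℝ] ℝ)
      hg' _ _ _
  rw [fderiv_metric_apply hd, fderiv_metric_apply hg]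
  simp only [prodLine_apply, fderiv_add_const]
  have h1 : DifferentiableAt ℝ (fun y => g y v.1 w.1) x.1 :=
    (hg.clm_apply (differentiableAt_const _)).clm_apply (differentiableAt_const _)
  have := (h1.hasFDerivAt.comp x hasFDerivAt_fst).fderiv
  rw [show (fun y : E × ℝ => g y.1 v.1 w.1) = (fun y => g y v.1 w.1) ∘ Prod.fst from rfl, this]
  simp

/-- The line factor is flat and the metric does not depend on `t`, so the pair on the right
satisfies the Koszul identity that determines the symbols. -/
theorem christoffel_prodLine [FiniteDimensional ℝ E] {g : E → E →L[ℝ] E →L[ℝ] ℝ} {x : E × ℝ}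
    (hd : DifferentiableAt ℝ g x.1) (hg : ∀ u, g x.1 u = 0 → u = 0) (u v : E × ℝ) :
    christoffel (prodLine g) x u v = (christoffel g x.1 u.1 v.1, 0) := by
  apply christoffel_eq
  · intro u hu
    have h1 : ∀ w, prodLine g x u w = 0 := by simp [hu]
    ext1
    · apply hg
      ext w
      simpa [prodLine_apply] using h1 (w, 0)
    · simpa [prodLine_apply] using h1 (0, 1)
  · intro w
    simp [prodLine_apply, fderiv_prodLine_apply hd, christoffel_spec hg]

theorem meanCurvatureVector_congr
    (g : E → E →L[ℝ] E →L[ℝ] ℝ)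
    {X Y : EuclideanSpace ℝ (Fin 2) → E} {w : EuclideanSpace ℝ (Fin 2)} (h : X =ᶠ[𝓝 w] Y) :
    meanCurvatureVector g X w = meanCurvatureVector g Y w := by
  have h1 (i : Fin 2) : tangentField X i =ᶠ[𝓝 w] tangentField Y i := by
    filter_upwards [h.fderiv (𝕜 := ℝ)] with w' hw
    simp only [tangentField, hw]
  have h2 : firstForm g X w = firstForm g Y w := by
    simp [firstForm, h.eq_of_nhds, (h1 _).eq_of_nhds]
  simp [meanCurvatureVector, secondForm, normalPart, h2, h.eq_of_nhds, (h1 _).eq_of_nhds,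
    (h1 _).fderiv_eq]

end General

/-! ### Metrics of the form `ds² + G dθ²`. -/

theorem plane_eq (u : Pl) : u = u 0 • e₀ + u 1 • e₁ := by
  ext i; fin_cases i <;> simp

/-- `g = ds² + G dθ²` near `y`, where `G = g(∂θ, ∂θ)`. -/
structure IsPolarFormAt (g : Pl → Pl →L[ℝ] Pl →L[ℝ] ℝ) (y : Pl) : Prop where
  contDiffAt : ContDiffAt ℝ ∞ g y
  symm : ∀ u v, g y u v = g y v u
  radial : g y e₀ e₀ = 1
  ortho : g y e₀ e₁ = 0
  pos : 0 < g y e₁ e₁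

theorem IsPolarFormAt.apply {g : Pl → Pl →L[ℝ] Pl →L[ℝ] ℝ} {y : Pl} (h : IsPolarFormAt g y)
    (u v : Pl) : g y u v = u 0 * v 0 + g y e₁ e₁ * u 1 * v 1 := by
  conv_lhs => rw [plane_eq u, plane_eq v]
  simp [h.radial, h.ortho, h.symm e₁ e₀]
  ring

theorem IsPolarFormAt.nondegenerate {g : Pl → Pl →L[ℝ] Pl →L[ℝ] ℝ} {y : Pl}
    (h : IsPolarFormAt g y) (u : Pl) (hu : g y u = 0) : u = 0 := by
  have h0 : g y u e₀ = 0 := by simp [hu]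
  have h1 : g y u e₁ = 0 := by simp [hu]
  rw [h.apply] at h0 h1
  simp at h0 h1
  ext i; fin_cases i
  · simpa using h0
  · simpa [h.pos.ne'] using h1

theorem differentiableAt_metric_apply {g : Pl → Pl →L[ℝ] Pl →L[ℝ] ℝ} {y : Pl}
    (hd : DifferentiableAt ℝ g y) (u v : Pl) : DifferentiableAt ℝ (fun y' => g y' u v) y :=
  (hd.clm_apply (differentiableAt_const _)).clm_apply (differentiableAt_const _)

theorem contDiffAt_metric_apply {g : Pl → Pl →L[ℝ] Pl →L[ℝ] ℝ} {y : Pl} {n : ℕ∞ω}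
    (hd : ContDiffAt ℝ n g y) (u v : Pl) : ContDiffAt ℝ n (fun y' => g y' u v) y :=
  (hd.clm_apply contDiffAt_const).clm_apply contDiffAt_const

/-- If the coordinate lines of `e₀` satisfy the geodesic equation at `y`, then
`∂₀ g(e₀, w) = ½ ∂_w g(e₀, e₀)`. -/
theorem fderiv_of_christoffel_eq_zero {g : Pl → Pl →L[ℝ] Pl →L[ℝ] ℝ} {y : Pl}
    (hd : DifferentiableAt ℝ g y) (hg : ∀ u, g y u = 0 → u = 0)
    (h : christoffel g y e₀ e₀ = 0) (w : Pl) :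
    fderiv ℝ (fun y' => g y' e₀ w) y e₀ = (1 / 2) * fderiv ℝ (fun y' => g y' e₀ e₀) y w := by
  have := christoffel_spec hg e₀ e₀ w
  rw [h, fderiv_metric_apply hd, fderiv_metric_apply hd] at this
  simp at this
  linarith

theorem IsPolarFormAt.fderiv_apply {g : Pl → Pl →L[ℝ] Pl →L[ℝ] ℝ} {y : Pl}
    (h : ∀ᶠ y' in 𝓝 y, IsPolarFormAt g y') (u v w : Pl) :
    fderiv ℝ g y u v w = fderiv ℝ (fun y' => g y' e₁ e₁) y u * v 1 * w 1 := by
  have hd : DifferentiableAt ℝ g y := h.self_of_nhds.contDiffAt.differentiableAt (by simp)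
  rw [fderiv_metric_apply hd]
  have : (fun y' => g y' v w) =ᶠ[𝓝 y] fun y' => v 0 * w 0 + g y' e₁ e₁ * (v 1 * w 1) := by
    filter_upwards [h] with y' hy'
    rw [hy'.apply]; ring
  rw [this.fderiv_eq, fderiv_const_add, fderiv_mul_const (differentiableAt_metric_apply hd _ _)]
  simp
  ring

theorem IsPolarFormAt.christoffel_eq {g : Pl → Pl →L[ℝ] Pl →L[ℝ] ℝ} {y : Pl}
    (h : ∀ᶠ y' in 𝓝 y, IsPolarFormAt g y') (u v : Pl) :
    christoffel g y u v =
      (-(1 / 2) * fderiv ℝ (fun y' => g y' e₁ e₁) y e₀ * (u 1 * v 1)) • e₀ +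
      ((fderiv ℝ (fun y' => g y' e₁ e₁) y u * v 1 + fderiv ℝ (fun y' => g y' e₁ e₁) y v * u 1
        - fderiv ℝ (fun y' => g y' e₁ e₁) y e₁ * u 1 * v 1) / (2 * g y e₁ e₁)) • e₁ := by
  have hp := h.self_of_nhds.pos.ne'
  apply CoordMetric.christoffel_eq h.self_of_nhds.nondegenerate
  intro w
  rw [h.self_of_nhds.apply]
  simp only [fderiv_apply h]
  have hw : fderiv ℝ (fun y' => g y' e₁ e₁) y w = w 0 * fderiv ℝ (fun y' => g y' e₁ e₁) y e₀ +
      w 1 * fderiv ℝ (fun y' => g y' e₁ e₁) y e₁ := by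
    conv_lhs => rw [plane_eq w]
    simp
  simp [hw]
  field_simp
  ring

/-- The Gauss curvature of `ds² + G dθ²`. -/
theorem IsPolarFormAt.sectionalCurvature_eq {g : Pl → Pl →L[ℝ] Pl →L[ℝ] ℝ} {y : Pl}
    (h : ∀ᶠ y' in 𝓝 y, IsPolarFormAt g y') :
    sectionalCurvature g y e₀ e₁ =
      (-(1 / 2) * fderiv ℝ (fun y' => fderiv ℝ (fun y'' => g y'' e₁ e₁) y' e₀) y e₀
        + (fderiv ℝ (fun y' => g y' e₁ e₁) y e₀) ^ 2 / (4 * g y e₁ e₁)) / g y e₁ e₁ := by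
  have hp := h.self_of_nhds.pos.ne'
  have h' := h.eventually_nhds
  have hG : ContDiffAt ℝ ∞ (fun y' => g y' e₁ e₁) y :=
    contDiffAt_metric_apply h.self_of_nhds.contDiffAt _ _
  have hG1 (u : Pl) : DifferentiableAt ℝ (fun y' => fderiv ℝ (fun y'' => g y'' e₁ e₁) y' u) y :=
    ((hG.fderiv_right (m := 1) (by norm_cast)).differentiableAt (by simp)).clm_apply
      (differentiableAt_const _)
  have hG0 : DifferentiableAt ℝ (fun y' => g y' e₁ e₁) y := hG.differentiableAt (by simp)
  have hG2 : 2 * g y e₁ e₁ ≠ 0 := mul_ne_zero two_ne_zero hp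
  have c11 : (fun y' => christoffel g y' e₁ e₁) =ᶠ[𝓝 y] fun y' =>
      (-(1 / 2) * fderiv ℝ (fun y'' => g y'' e₁ e₁) y' e₀) • e₀ +
      (fderiv ℝ (fun y'' => g y'' e₁ e₁) y' e₁ / (2 * g y' e₁ e₁)) • e₁ := by
    filter_upwards [h'] with y' hy'
    rw [christoffel_eq hy']
    simp
  have c01 : (fun y' => christoffel g y' e₀ e₁) =ᶠ[𝓝 y] fun y' =>
      (fderiv ℝ (fun y'' => g y'' e₁ e₁) y' e₀ / (2 * g y' e₁ e₁)) • e₁ := by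
    filter_upwards [h'] with y' hy'
    rw [christoffel_eq hy']
    simp
  -- Since `e₀` is a unit vector orthogonal to `e₁`, the numerator `g(R(e₀, e₁)e₁, e₀)` is the
  -- `e₀`-component of the curvature tensor; only this component of the derivatives is needed.
  have d11 : (fderiv ℝ (fun y' => christoffel g y' e₁ e₁) y e₀) 0 =
      -(1 / 2) * fderiv ℝ (fun y' => fderiv ℝ (fun y'' => g y'' e₁ e₁) y' e₀) y e₀ := by
    have hb : DifferentiableAt ℝ
        (fun y' => fderiv ℝ (fun y'' => g y'' e₁ e₁) y' e₁ / (2 * g y' e₁ e₁)) y := by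
      simp only [div_eq_mul_inv]
      exact (hG1 e₁).fun_mul ((hG0.const_mul 2).fun_inv hG2)
    rw [c11.fderiv_eq, (((((hG1 e₀).hasFDerivAt.const_mul (-(1 / 2))).smul_const e₀).fun_add
      (hb.hasFDerivAt.smul_const e₁))).fderiv]
    simp
  have d01 : (fderiv ℝ (fun y' => christoffel g y' e₀ e₁) y e₁) 0 = 0 := by
    have hb : DifferentiableAt ℝ
        (fun y' => fderiv ℝ (fun y'' => g y'' e₁ e₁) y' e₀ / (2 * g y' e₁ e₁)) y := by
      simp only [div_eq_mul_inv]
      exact (hG1 e₀).fun_mul ((hG0.const_mul 2).fun_inv hG2)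
    rw [c01.fderiv_eq, (hb.hasFDerivAt.smul_const e₁).fderiv]
    simp
  have hs := h.self_of_nhds
  rw [sectionalCurvature, hs.apply, hs.radial, hs.ortho, curvatureTensor]
  simp only [PiLp.add_apply, PiLp.sub_apply, d11, d01]
  simp [christoffel_eq h]
  field_simp
  ring

/-! ### Mean curvature of a surface of revolution in the product. -/

/-- The parametrized surface of revolution with meridian `(s, z)`, in polar coordinates. -/
def revolution (s z : ℝ → ℝ) (u₀ θ₀ : ℝ) (w : Pl) : Pl × ℝ :=
  (s (u₀ + w 0) • e₀ + (θ₀ + w 1) • e₁, z (u₀ + w 0))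

theorem hasFDerivAt_add_coord (c : ℝ) (i : Fin 2) (w : Pl) :
    HasFDerivAt (fun w : Pl => c + w i) (EuclideanSpace.proj i : Pl →L[ℝ] ℝ) w :=
  (EuclideanSpace.proj (𝕜 := ℝ) i).hasFDerivAt.const_add c

theorem hasFDerivAt_comp_add_coord {f : ℝ → ℝ} {f' c : ℝ} {i : Fin 2} {w : Pl}
    (hf : HasDerivAt f f' (c + w i)) :
    HasFDerivAt (fun w : Pl => f (c + w i)) (f' • (EuclideanSpace.proj i : Pl →L[ℝ] ℝ)) w :=
  hf.comp_hasFDerivAt w (hasFDerivAt_add_coord c i w)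

theorem hasFDerivAt_revolution {s z : ℝ → ℝ} {s' z' u₀ θ₀ : ℝ} {w : Pl}
    (hs : HasDerivAt s s' (u₀ + w 0)) (hz : HasDerivAt z z' (u₀ + w 0)) :
    HasFDerivAt (revolution s z u₀ θ₀)
      (((s' • (EuclideanSpace.proj 0 : Pl →L[ℝ] ℝ)).smulRight e₀ +
        (EuclideanSpace.proj 1 : Pl →L[ℝ] ℝ).smulRight e₁).prod
        (z' • (EuclideanSpace.proj 0 : Pl →L[ℝ] ℝ))) w :=
  (((hasFDerivAt_comp_add_coord hs).smul_const e₀).fun_add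
    ((hasFDerivAt_add_coord θ₀ 1 w).smul_const e₁)).prodMk (hasFDerivAt_comp_add_coord hz)

/-- The vector `(z' e₀, -s')` is normal to the surface. The first summand of its coefficient is the
bending of the meridian and the second that of the parallel, where `∂₀G / (2G)` is the logarithmic
derivative of `√G`. Derivatives of `G` in the angle contribute only tangentially. -/
theorem meanCurvatureVector_revolution {g : Pl → Pl →L[ℝ] Pl →L[ℝ] ℝ}
    {s z s' z' : ℝ → ℝ} {s'' z'' u₀ θ₀ : ℝ}
    (hs : ∀ u, HasDerivAt s (s' u) u) (hz : ∀ u, HasDerivAt z (z' u) u)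
    (hs' : HasDerivAt s' s'' u₀) (hz' : HasDerivAt z' z'' u₀)
    (ha : s' u₀ ^ 2 + z' u₀ ^ 2 ≠ 0)
    (h : ∀ᶠ y in 𝓝 (s u₀ • e₀ + θ₀ • e₁), IsPolarFormAt g y) :
    meanCurvatureVector (prodLine g) (revolution s z u₀ θ₀) 0 =
      ((1 / 2) * (s' u₀ ^ 2 + z' u₀ ^ 2)⁻¹ *
        ((s'' * z' u₀ - z'' * s' u₀) / (s' u₀ ^ 2 + z' u₀ ^ 2) -
          fderiv ℝ (fun y => g y e₁ e₁) (s u₀ • e₀ + θ₀ • e₁) e₀ /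
            (2 * g (s u₀ • e₀ + θ₀ • e₁) e₁ e₁) * z' u₀)) • (z' u₀ • e₀, -s' u₀) := by
  set y₀ := s u₀ • e₀ + θ₀ • e₁ with hy₀
  set X := revolution s z u₀ θ₀ with hX
  have hp := h.self_of_nhds.pos.ne'
  have hX0 : X 0 = (y₀, z u₀) := by simp [hX, revolution, hy₀]
  have t0 : tangentField X 0 = fun w => (s' (u₀ + w 0) • e₀, z' (u₀ + w 0)) := by
    ext1 w
    rw [tangentField, (hasFDerivAt_revolution (hs _) (hz _)).fderiv]
    simp
  have t1 : tangentField X 1 = fun w => (e₁, 0) := by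
    ext1 w
    rw [tangentField, (hasFDerivAt_revolution (hs _) (hz _)).fderiv]
    simp
  have t00 : fderiv ℝ (tangentField X 0) 0 e₀ = (s'' • e₀, z'') := by
    rw [t0, (((hasFDerivAt_comp_add_coord (by simpa using hs')).smul_const e₀).prodMk
      (hasFDerivAt_comp_add_coord (by simpa using hz'))).fderiv]
    simp
  have t11 : fderiv ℝ (tangentField X 1) 0 e₁ = 0 := by simp [t1]
  have hs0 := h.self_of_nhds
  have hff : firstForm (prodLine g) X 0 =
      Matrix.diagonal ![s' u₀ ^ 2 + z' u₀ ^ 2, g y₀ e₁ e₁] := by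
    ext i j
    fin_cases i <;> fin_cases j <;>
      simp [firstForm, t0, t1, hX0, prodLine_apply, hs0.radial, hs0.ortho, hs0.symm e₁ e₀]
    ring
  have hinv : (firstForm (prodLine g) X 0)⁻¹ =
      Matrix.diagonal ![(s' u₀ ^ 2 + z' u₀ ^ 2)⁻¹, (g y₀ e₁ e₁)⁻¹] := by
    rw [hff]
    apply Matrix.inv_eq_right_inv
    rw [Matrix.diagonal_mul_diagonal, ← Matrix.diagonal_one]
    congr 1
    ext i; fin_cases i
    · exact mul_inv_cancel₀ ha
    · exact mul_inv_cancel₀ hp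
  have hch (u v : Pl × ℝ) : christoffel (prodLine g) (y₀, z u₀) u v =
      (christoffel g y₀ u.1 v.1, 0) :=
    christoffel_prodLine (hs0.contDiffAt.differentiableAt (by simp)) hs0.nondegenerate u v
  have s00 : secondForm (prodLine g) X 0 0 0 =
      ((s'' * z' u₀ - z'' * s' u₀) / (s' u₀ ^ 2 + z' u₀ ^ 2)) • (z' u₀ • e₀, -s' u₀) := by
    rw [secondForm, normalPart, hinv, t00, hX0, hch]
    simp [t0, t1, Fin.sum_univ_two, IsPolarFormAt.christoffel_eq h, prodLine_apply, hs0.radial,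
      hs0.ortho]
    constructor
    · simp only [smul_smul, ← sub_smul]
      congr 1
      field_simp
      ring
    · field_simp
      ring
  have s11 : secondForm (prodLine g) X 0 1 1 =
      (-(1 / 2) * fderiv ℝ (fun y => g y e₁ e₁) y₀ e₀ / (s' u₀ ^ 2 + z' u₀ ^ 2) * z' u₀) •
        (z' u₀ • e₀, -s' u₀) := by
    rw [secondForm, normalPart, hinv, t11, hX0, hch]
    simp [t0, t1, Fin.sum_univ_two, IsPolarFormAt.christoffel_eq h, prodLine_apply, hs0.radial,
      hs0.ortho, hs0.symm e₁ e₀]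
    constructor
    · ext i; fin_cases i <;> simp
      · field_simp
        ring
      · field_simp
        ring
    · field_simp
  -- The inverse first fundamental form is diagonal, so the mixed terms of the second fundamental
  -- form drop out.
  rw [meanCurvatureVector, hinv]
  simp only [Fin.sum_univ_two, s00, s11]
  simp
  constructor
  · simp only [smul_smul, ← add_smul]
    congr 1
    field_simp
    ring
  · field_simp
    ring

end CoordMetric

/-! ### The meridian of the catenoid, parametrized smoothly through the neck. -/

namespace RiemannianSurface

/-- Half of the meridian: the distance to the axis, with `sinh (k s) = A cosh u`. -/
def meridianRadius (A k u : ℝ) : ℝ := Real.arsinh (A * Real.cosh u) / k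

/-- The speed of the height of the meridian. -/
def meridianSlope (A k u : ℝ) : ℝ := A / (k * Real.sqrt (1 + (A * Real.cosh u) ^ 2))

/-- The height of the meridian. -/
def meridianHeight (A k u : ℝ) : ℝ := ∫ v in (0 : ℝ)..u, meridianSlope A k v

section

variable {A k : ℝ}

theorem meridianSlope_pos (hA : 0 < A) (hk : 0 < k) (u : ℝ) : 0 < meridianSlope A k u := by
  unfold meridianSlope; positivity

theorem sinh_meridianRadius (hk : 0 < k) (u : ℝ) :
    Real.sinh (k * meridianRadius A k u) = A * Real.cosh u := by
  rw [meridianRadius, mul_div_cancel₀ _ hk.ne', Real.sinh_arsinh]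

theorem cosh_meridianRadius (hk : 0 < k) (u : ℝ) :
    Real.cosh (k * meridianRadius A k u) = Real.sqrt (1 + (A * Real.cosh u) ^ 2) := by
  rw [meridianRadius, mul_div_cancel₀ _ hk.ne', Real.cosh_arsinh]

theorem meridianRadius_pos (hA : 0 < A) (hk : 0 < k) (u : ℝ) : 0 < meridianRadius A k u :=
  div_pos (Real.arsinh_pos_iff.2 (mul_pos hA (Real.cosh_pos u))) hk

theorem hasDerivAt_meridianRadius (A k u : ℝ) :
    HasDerivAt (meridianRadius A k) (Real.sinh u * meridianSlope A k u) u := by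
  have := (((Real.hasDerivAt_cosh u).const_mul A).arsinh).div_const k
  refine this.congr_deriv ?_
  simp only [meridianSlope, smul_eq_mul]
  ring

theorem contDiff_meridianRadius (A k : ℝ) : ContDiff ℝ ∞ (meridianRadius A k) :=
  (Real.contDiff_arsinh.comp (contDiff_const.mul Real.contDiff_cosh)).div_const k

theorem contDiff_meridianSlope (A : ℝ) (hk : 0 < k) : ContDiff ℝ ∞ (meridianSlope A k) := by
  refine contDiff_const.div (contDiff_const.mul (ContDiff.sqrt ?_ fun u => ?_)) fun u => ?_
  · exact contDiff_const.add ((contDiff_const.mul Real.contDiff_cosh).pow 2)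
  all_goals positivity

theorem hasDerivAt_meridianHeight (A : ℝ) (hk : 0 < k) (u : ℝ) :
    HasDerivAt (meridianHeight A k) (meridianSlope A k u) u :=
  ((contDiff_meridianSlope A hk).continuous.integral_hasStrictDerivAt 0 u).hasDerivAt

theorem contDiff_meridianHeight (A : ℝ) (hk : 0 < k) : ContDiff ℝ ∞ (meridianHeight A k) := by
  have h : deriv (meridianHeight A k) = meridianSlope A k :=
    funext fun u => (hasDerivAt_meridianHeight A hk u).deriv
  rw [contDiff_infty_iff_deriv, h]
  exact ⟨fun u => (hasDerivAt_meridianHeight A hk u).differentiableAt,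
    contDiff_meridianSlope A hk⟩

theorem meridianHeight_zero (A k : ℝ) : meridianHeight A k 0 = 0 := by
  simp [meridianHeight]

theorem meridianHeight_neg (A k u : ℝ) : meridianHeight A k (-u) = -meridianHeight A k u := by
  have h := intervalIntegral.integral_comp_neg (a := 0) (b := u) (meridianSlope A k)
  have h' : ∀ v, meridianSlope A k (-v) = meridianSlope A k v := fun v => by
    simp [meridianSlope]
  simp only [h', neg_zero] at h
  rw [meridianHeight, meridianHeight, h, intervalIntegral.integral_symm]

theorem strictMono_meridianHeight (hA : 0 < A) (hk : 0 < k) :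
    StrictMono (meridianHeight A k) :=
  strictMono_of_deriv_pos fun u => by
    rw [(hasDerivAt_meridianHeight A hk u).deriv]; exact meridianSlope_pos hA hk u

theorem meridianRadius_neg (A k u : ℝ) : meridianRadius A k (-u) = meridianRadius A k u := by
  simp [meridianRadius]

theorem meridianRadius_zero (A k : ℝ) : meridianRadius A k 0 = neckRadius A k := by
  simp [meridianRadius, neckRadius]

theorem strictMonoOn_meridianRadius (hA : 0 < A) (hk : 0 < k) :
    StrictMonoOn (meridianRadius A k) (Ici 0) := fun _ hu _ hv huv =>
  div_lt_div_of_pos_right (Real.arsinh_lt_arsinh.2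
    (mul_lt_mul_of_pos_left (Real.cosh_strictMonoOn hu hv huv) hA)) hk

theorem meridianRadius_abs (A k u : ℝ) : meridianRadius A k |u| = meridianRadius A k u := by
  rcases abs_choice u with h | h <;> simp [h, meridianRadius_neg]

theorem neckRadius_le_meridianRadius (hA : 0 < A) (hk : 0 < k) (u : ℝ) :
    neckRadius A k ≤ meridianRadius A k u := by
  rw [← meridianRadius_zero, ← meridianRadius_abs A k u]
  exact (strictMonoOn_meridianRadius hA hk).monotoneOn self_mem_Ici (abs_nonneg u) (abs_nonneg u)

theorem exists_meridianRadius_eq (hA : 0 < A) (hk : 0 < k) {s : ℝ} (hs : neckRadius A k ≤ s) :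
    ∃ u, 0 ≤ u ∧ meridianRadius A k u = s := by
  have h1 : A ≤ Real.sinh (k * s) := by
    rw [← Real.sinh_arsinh A, Real.sinh_le_sinh]
    rw [neckRadius, div_le_iff₀ hk] at hs
    linarith
  have h2 : 1 ≤ Real.sinh (k * s) / A := by rwa [one_le_div hA]
  refine ⟨Real.arcosh (Real.sinh (k * s) / A), Real.arcosh_nonneg h2, ?_⟩
  rw [meridianRadius, Real.cosh_arcosh h2, mul_div_cancel₀ _ hA.ne', Real.arsinh_sinh,
    mul_div_cancel_left₀ _ hk.ne']

/-- The slope is at most `1 / (k cosh u)`, the derivative of `arctan (sinh u) / k`, which is below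
`π / (2k)`. The added `1` is mere slack. -/
theorem meridianHeight_lt (hk : 0 < k) (hA : 0 < A) (u : ℝ) :
    meridianHeight A k u < Real.pi / (2 * k) + 1 := by
  have hd (u : ℝ) : HasDerivAt (fun u => Real.arctan (Real.sinh u) / k - meridianHeight A k u)
      (1 / (1 + Real.sinh u ^ 2) * Real.cosh u / k - meridianSlope A k u) u :=
    ((Real.hasDerivAt_sinh u).arctan.div_const k).sub (hasDerivAt_meridianHeight A hk u)
  have hmono : Monotone (fun u => Real.arctan (Real.sinh u) / k - meridianHeight A k u) := by
    apply monotone_of_deriv_nonneg fun u => (hd u).differentiableAt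
    intro u
    rw [(hd u).deriv, sub_nonneg, meridianSlope, add_comm 1 (Real.sinh u ^ 2), ← Real.cosh_sq]
    have hc := Real.cosh_pos u
    have h1 : A * Real.cosh u ≤ Real.sqrt (1 + (A * Real.cosh u) ^ 2) :=
      Real.le_sqrt_of_sq_le (by linarith)
    have h2 : 1 / Real.cosh u ^ 2 * Real.cosh u / k = A / (k * (A * Real.cosh u)) := by
      field_simp
    rw [h2]
    gcongr
  rcases le_total 0 u with hu | hu
  · have h := hmono hu
    simp only [Real.sinh_zero, Real.arctan_zero, zero_div, meridianHeight_zero, sub_zero] at h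
    have h3 : Real.arctan (Real.sinh u) / k ≤ Real.pi / 2 / k := by
      gcongr; exact (Real.arctan_lt_pi_div_two _).le
    rw [div_div] at h3
    linarith
  · have := (strictMono_meridianHeight hA hk).monotone hu
    rw [meridianHeight_zero] at this
    have : 0 < Real.pi / (2 * k) := by positivity
    linarith

/-- This is the substitution `sinh (k r) = A cosh v`, under which the root becomes `A sinh v`. It is
made on open intervals, because the integrand is singular at the neck. -/
theorem profile_meridianRadius (hA : 0 < A) (hk : 0 < k) {u : ℝ} (hu : 0 ≤ u) :
    profile A k (meridianRadius A k u) = meridianHeight A k u := by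
  have hmono := strictMonoOn_meridianRadius hA hk
  have himage : meridianRadius A k '' Ioo 0 u = Ioo (neckRadius A k) (meridianRadius A k u) := by
    ext r
    constructor
    · rintro ⟨v, hv, rfl⟩
      rw [← meridianRadius_zero]
      exact ⟨hmono self_mem_Ici hv.1.le hv.1, hmono hv.1.le hu hv.2⟩
    · intro hr
      obtain ⟨v, hv, rfl⟩ := exists_meridianRadius_eq hA hk hr.1.le
      refine ⟨v, ⟨hv.lt_of_ne ?_, (hmono.lt_iff_lt hv hu).1 hr.2⟩, rfl⟩
      rintro rfl
      exact hr.1.ne (meridianRadius_zero A k).symm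
  rw [profile, intervalIntegral.integral_of_le (neckRadius_le_meridianRadius hA hk u),
    MeasureTheory.integral_Ioc_eq_integral_Ioo, ← himage,
    MeasureTheory.integral_image_eq_integral_abs_deriv_smul measurableSet_Ioo
      (fun v _ => (hasDerivAt_meridianRadius A k v).hasDerivWithinAt)
      (hmono.injOn.mono fun v hv => hv.1.le),
    meridianHeight, intervalIntegral.integral_of_le hu,
    MeasureTheory.integral_Ioc_eq_integral_Ioo]
  refine MeasureTheory.setIntegral_congr_fun measurableSet_Ioo fun v hv => ?_
  have hs : 0 < Real.sinh v := Real.sinh_pos_iff.2 hv.1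
  have h1 : Real.sqrt ((A * Real.cosh v) ^ 2 - A ^ 2) = A * Real.sinh v := by
    rw [show (A * Real.cosh v) ^ 2 - A ^ 2 = (A * Real.sinh v) ^ 2 by
      rw [mul_pow, mul_pow, Real.cosh_sq]; ring]
    exact Real.sqrt_sq (by positivity)
  simp only [sinh_meridianRadius hk, h1, smul_eq_mul]
  rw [abs_of_pos (mul_pos hs (meridianSlope_pos hA hk v))]
  field_simp

end

/-! ### Polar coordinates in the plane -/

/-- The plane as the complex plane, rotated by `-θ₀`. -/
def rotateToComplex (θ₀ : ℝ) (p : Plane) : ℂ :=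
  ⟨p 0 * Real.cos θ₀ + p 1 * Real.sin θ₀, p 1 * Real.cos θ₀ - p 0 * Real.sin θ₀⟩

theorem contDiff_rotateToComplex (θ₀ : ℝ) : ContDiff ℝ ∞ (rotateToComplex θ₀) := by
  have h : rotateToComplex θ₀ = fun p : Plane =>
      ((p 0 * Real.cos θ₀ + p 1 * Real.sin θ₀ : ℝ) : ℂ) +
        ((p 1 * Real.cos θ₀ - p 0 * Real.sin θ₀ : ℝ) : ℂ) * Complex.I := by
    ext1 p
    apply Complex.ext <;> simp only [rotateToComplex, Complex.add_re, Complex.add_im,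
      Complex.mul_re, Complex.mul_im, Complex.ofReal_re, Complex.ofReal_im, Complex.I_re,
      Complex.I_im] <;> ring
  rw [h]
  have h0 (i : Fin 2) : ContDiff ℝ ∞ fun p : Plane => p i :=
    (EuclideanSpace.proj (𝕜 := ℝ) i).contDiff
  refine (Complex.ofRealCLM.contDiff.comp ?_).add ((Complex.ofRealCLM.contDiff.comp ?_).mul
    contDiff_const)
  · exact ((h0 0).mul contDiff_const).add ((h0 1).mul contDiff_const)
  · exact ((h0 1).mul contDiff_const).sub ((h0 0).mul contDiff_const)

theorem norm_rotateToComplex (θ₀ : ℝ) (p : Plane) : ‖rotateToComplex θ₀ p‖ = ‖p‖ := by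
  rw [Complex.norm_def, EuclideanSpace.norm_eq, Fin.sum_univ_two]
  congr 1
  simp only [Complex.normSq_apply, rotateToComplex, Real.norm_eq_abs, sq_abs]
  linear_combination (p 0 ^ 2 + p 1 ^ 2) * Real.cos_sq_add_sin_sq θ₀

theorem rotateToComplex_polar (θ₀ s θ : ℝ) :
    rotateToComplex θ₀ (polar s θ) =
      (s : ℂ) * (Complex.cos ((θ - θ₀ : ℝ) : ℂ) + Complex.sin ((θ - θ₀ : ℝ) : ℂ) * Complex.I) := by
  rw [← Complex.ofReal_cos, ← Complex.ofReal_sin, Real.cos_sub, Real.sin_sub]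
  apply Complex.ext <;> simp only [rotateToComplex, polar, Complex.add_re, Complex.add_im,
    Complex.mul_re, Complex.mul_im, Complex.ofReal_re, Complex.ofReal_im, Complex.I_re,
    Complex.I_im, Matrix.cons_val_zero, Matrix.cons_val_one] <;> ring

theorem norm_polar (s θ : ℝ) : ‖polar s θ‖ = |s| := by
  rw [← norm_rotateToComplex 0, rotateToComplex_polar, norm_mul, Complex.norm_cos_add_sin_mul_I]
  simp

theorem polar_norm_arg (θ₀ : ℝ) (p : Plane) :
    polar ‖p‖ (θ₀ + Complex.arg (rotateToComplex θ₀ p)) = p := by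
  have hc := Complex.norm_mul_cos_arg (rotateToComplex θ₀ p)
  have hs := Complex.norm_mul_sin_arg (rotateToComplex θ₀ p)
  rw [norm_rotateToComplex] at hc hs
  have h1 := Real.cos_sq_add_sin_sq θ₀
  generalize Complex.arg (rotateToComplex θ₀ p) = a at hc hs ⊢
  simp only [rotateToComplex] at hc hs
  ext i
  fin_cases i
  · simp only [polar, Real.cos_add, Fin.zero_eta, Matrix.cons_val_zero]
    linear_combination p 0 * h1 + Real.cos θ₀ * hc - Real.sin θ₀ * hs
  · simp only [polar, Real.sin_add, Fin.mk_one, Matrix.cons_val_one,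
      Matrix.cons_val_fin_one]
    linear_combination p 1 * h1 + Real.sin θ₀ * hc + Real.cos θ₀ * hs

theorem contDiff_polar : ContDiff ℝ ∞ fun y : Plane => polar (y 0) (y 1) := by
  have h0 (i : Fin 2) : ContDiff ℝ ∞ fun p : Plane => p i :=
    (EuclideanSpace.proj (𝕜 := ℝ) i).contDiff
  rw [contDiff_euclidean]
  intro i
  fin_cases i
  · exact (h0 0).mul (Real.contDiff_cos.comp (h0 1))
  · exact (h0 0).mul (Real.contDiff_sin.comp (h0 1))

theorem contDiffOn_polarChart (θ₀ : ℝ) :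
    ContDiffOn ℝ ∞ (fun p : Plane => (!₂[‖p‖, θ₀ + Complex.arg (rotateToComplex θ₀ p)] : Plane))
      (rotateToComplex θ₀ ⁻¹' Complex.slitPlane) := by
  intro p hp
  have hp0 : p ≠ 0 := by
    rintro rfl
    exact Complex.slitPlane_ne_zero hp (by simp [rotateToComplex, Complex.ext_iff])
  refine ContDiffAt.contDiffWithinAt ?_
  rw [contDiffAt_euclidean]
  intro i
  fin_cases i
  · exact contDiffAt_norm ℝ hp0
  · have h1 : ContDiffAt ℝ ∞ (fun p => Complex.log (rotateToComplex θ₀ p)) p :=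
      ((Complex.contDiffAt_log hp).restrict_scalars ℝ).comp p
        (contDiff_rotateToComplex θ₀).contDiffAt
    have h2 : ContDiffAt ℝ ∞ (fun p => Complex.arg (rotateToComplex θ₀ p)) p := by
      simp only [← Complex.log_im]
      exact Complex.imCLM.contDiff.contDiffAt.comp p h1
    exact contDiffAt_const.add h2

/-- Polar coordinates `(s, θ)` on a slit plane, with `|θ - θ₀| < π`. -/
def polarChart (θ₀ : ℝ) : OpenPartialHomeomorph Plane Plane where
  toFun p := !₂[‖p‖, θ₀ + Complex.arg (rotateToComplex θ₀ p)]
  invFun y := polar (y 0) (y 1)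
  source := rotateToComplex θ₀ ⁻¹' Complex.slitPlane
  target := {y | 0 < y 0 ∧ y 1 - θ₀ ∈ Ioo (-Real.pi) Real.pi}
  map_source' p hp := by
    have h0 : rotateToComplex θ₀ p ≠ 0 := Complex.slitPlane_ne_zero hp
    rw [← norm_pos_iff, norm_rotateToComplex] at h0
    simp only [mem_ofPred_eq, Matrix.cons_val_zero, Matrix.cons_val_one, add_sub_cancel_left]
    exact ⟨h0, Complex.neg_pi_lt_arg _,
      (Complex.arg_le_pi _).lt_of_ne (Complex.mem_slitPlane_iff_arg.1 hp).1⟩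
  map_target' y hy := by
    rw [mem_preimage, rotateToComplex_polar, Complex.mem_slitPlane_iff_arg,
      Complex.arg_mul_cos_add_sin_mul_I hy.1 ⟨hy.2.1, hy.2.2.le⟩]
    refine ⟨hy.2.2.ne, ?_⟩
    rw [← norm_ne_zero_iff, norm_mul, Complex.norm_cos_add_sin_mul_I]
    simpa using hy.1.ne'
  left_inv' p _ := polar_norm_arg θ₀ p
  right_inv' y hy := by
    rw [rotateToComplex_polar, Complex.arg_mul_cos_add_sin_mul_I hy.1 ⟨hy.2.1, hy.2.2.le⟩,
      norm_polar, abs_of_pos hy.1]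
    ext i; fin_cases i <;> simp
  open_source := Complex.isOpen_slitPlane.preimage (contDiff_rotateToComplex θ₀).continuous
  open_target := by
    have h0 (i : Fin 2) : Continuous fun p : Plane => p i :=
      (EuclideanSpace.proj (𝕜 := ℝ) i).continuous
    exact (isOpen_lt continuous_const (h0 0)).inter
      (isOpen_Ioo.preimage ((h0 1).sub continuous_const))
  continuousOn_toFun := (contDiffOn_polarChart θ₀).continuousOn
  continuousOn_invFun := contDiff_polar.continuous.continuousOn

/-! ### The chart of a surface given by geodesic polar coordinates -/

section

variable {M : Type*} [MetricSpace M] [ChartedSpace Plane M]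

/-- Geodesic polar coordinates `(s, θ)` with `|θ - θ₀| < π`. -/
def geodesicPolarChart (F : Plane ≃ₘ⟮𝓘(ℝ, Plane), 𝓘(ℝ, Plane)⟯ M) (θ₀ : ℝ) :
    OpenPartialHomeomorph M Plane :=
  F.symm.toHomeomorph.toOpenPartialHomeomorph.trans (polarChart θ₀)

variable (F : Plane ≃ₘ⟮𝓘(ℝ, Plane), 𝓘(ℝ, Plane)⟯ M) (θ₀ : ℝ)

theorem geodesicPolarChart_symm_apply (y : Plane) :
    (geodesicPolarChart F θ₀).symm y = F (polar (y 0) (y 1)) := rfl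

theorem geodesicPolarChart_apply (q : M) : geodesicPolarChart F θ₀ q =
    !₂[‖F.symm q‖, θ₀ + Complex.arg (rotateToComplex θ₀ (F.symm q))] := rfl

theorem mem_geodesicPolarChart_target {y : Plane} :
    y ∈ (geodesicPolarChart F θ₀).target ↔ 0 < y 0 ∧ y 1 - θ₀ ∈ Ioo (-Real.pi) Real.pi := by
  simp [geodesicPolarChart, polarChart]

theorem mem_geodesicPolarChart_source {q : M} :
    q ∈ (geodesicPolarChart F θ₀).source ↔ rotateToComplex θ₀ (F.symm q) ∈ Complex.slitPlane := by
  simp [geodesicPolarChart, polarChart]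

theorem apply_polar_mem_geodesicPolarChart_source {y : Plane}
    (hy : y ∈ (geodesicPolarChart F θ₀).target) :
    F (polar (y 0) (y 1)) ∈ (geodesicPolarChart F θ₀).source :=
  (geodesicPolarChart F θ₀).map_target hy

theorem smul_add_smul_mem_geodesicPolarChart_target {t : ℝ} (ht : 0 < t) :
    t • EuclideanSpace.single 0 1 + θ₀ • EuclideanSpace.single 1 1 ∈
      (geodesicPolarChart F θ₀).target := by
  rw [mem_geodesicPolarChart_target]
  simpa [Real.pi_pos] using ht

theorem mem_source_of_pos {t : ℝ} (ht : 0 < t) :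
    F (polar t θ₀) ∈ (geodesicPolarChart F θ₀).source := by
  simpa using apply_polar_mem_geodesicPolarChart_source F θ₀
    (smul_add_smul_mem_geodesicPolarChart_target F θ₀ ht)

theorem geodesicPolarChart_apply_polar {y : Plane}
    (hy : y ∈ (geodesicPolarChart F θ₀).target) :
    geodesicPolarChart F θ₀ (F (polar (y 0) (y 1))) = y :=
  (geodesicPolarChart F θ₀).right_inv hy

theorem geodesicPolarChart_apply_polar_of_pos {t : ℝ} (ht : 0 < t) :
    geodesicPolarChart F θ₀ (F (polar t θ₀)) =
      t • EuclideanSpace.single 0 1 + θ₀ • EuclideanSpace.single 1 1 := by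
  simpa using geodesicPolarChart_apply_polar F θ₀
    (smul_add_smul_mem_geodesicPolarChart_target F θ₀ ht)

theorem contMDiff_comp_polar :
    ContMDiff 𝓘(ℝ, Plane) 𝓘(ℝ, Plane) ∞ fun y : Plane => F (polar (y 0) (y 1)) :=
  F.contMDiff.comp contDiff_polar.contMDiff

theorem geodesicPolarChart_mem_maximalAtlas [IsManifold 𝓘(ℝ, Plane) ∞ M] :
    geodesicPolarChart F θ₀ ∈ IsManifold.maximalAtlas 𝓘(ℝ, Plane) ∞ M := by
  refine (geodesicPolarChart F θ₀).mem_maximalAtlas_of_contMDiffOn ?_ ?_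
  · refine (contDiffOn_polarChart θ₀).contMDiffOn.comp F.symm.contMDiff.contMDiffOn fun q hq => ?_
    exact (mem_geodesicPolarChart_source F θ₀).1 hq
  · exact (contMDiff_comp_polar F).contMDiffOn

end

/-! ### The metric in geodesic polar coordinates and the Gauss lemma. -/

section

variable {M : Type*} [MetricSpace M] [ChartedSpace Plane M]
  [RiemannianBundle (fun x : M => TangentSpace 𝓘(ℝ, Plane) x)]

/-- The metric pulled back by a map `Φ` from the plane. -/
def pullbackForm (Φ : Plane → M) (y u v : Plane) : ℝ :=
  inner ℝ (mfderiv 𝓘(ℝ, Plane) 𝓘(ℝ, Plane) Φ y u) (mfderiv 𝓘(ℝ, Plane) 𝓘(ℝ, Plane) Φ y v)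

theorem chartMetric_apply (φ : OpenPartialHomeomorph M Plane) (y u v : Plane) :
    chartMetric φ y u v = pullbackForm φ.symm y u v := rfl

variable [IsManifold 𝓘(ℝ, Plane) ∞ M]
  [IsContMDiffRiemannianBundle 𝓘(ℝ, Plane) ∞ Plane (fun x : M => TangentSpace 𝓘(ℝ, Plane) x)]

theorem contDiff_pullbackForm {Φ : Plane → M} (hΦ : ContMDiff 𝓘(ℝ, Plane) 𝓘(ℝ, Plane) ∞ Φ)
    {U V : Plane → Plane} (hU : ContDiff ℝ ∞ U) (hV : ContDiff ℝ ∞ V) :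
    ContDiff ℝ ∞ fun y => pullbackForm Φ y (U y) (V y) := by
  have key {U : Plane → Plane} (hU : ContDiff ℝ ∞ U) :
      ContMDiff 𝓘(ℝ, Plane) 𝓘(ℝ, Plane).tangent ∞
        (fun y =>
          (⟨Φ y, mfderiv 𝓘(ℝ, Plane) 𝓘(ℝ, Plane) Φ y (U y)⟩ : TangentBundle 𝓘(ℝ, Plane) M)) := by
    have h1 : ContMDiff 𝓘(ℝ, Plane) 𝓘(ℝ, Plane).tangent ∞
        (fun y => (⟨y, U y⟩ : TangentBundle 𝓘(ℝ, Plane) Plane)) := fun y =>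
      contMDiffAt_vectorSpace_iff_contDiffAt.2 hU.contDiffAt
    exact (hΦ.contMDiff_tangentMap (m := ∞) (by simp)).comp h1
  exact ((key hU).inner_bundle (key hV)).contDiff

end

theorem hasFDerivAt_polar (y : Plane) :
    HasFDerivAt (fun y : Plane => polar (y 0) (y 1))
      ((EuclideanSpace.proj 0 : Plane →L[ℝ] ℝ).smulRight (polar 1 (y 1)) +
        (y 0 • (EuclideanSpace.proj 1 : Plane →L[ℝ] ℝ)).smulRight
          (polar 1 (y 1 + Real.pi / 2))) y := by
  have h0 (i : Fin 2) : HasFDerivAt (fun p : Plane => p i)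
      (EuclideanSpace.proj i : Plane →L[ℝ] ℝ) y := (EuclideanSpace.proj (𝕜 := ℝ) i).hasFDerivAt
  rw [← hasFDerivWithinAt_univ, hasFDerivWithinAt_euclidean]
  intro i
  rw [hasFDerivWithinAt_univ]
  fin_cases i
  · refine ((h0 0).mul (h0 1).cos).congr_fderiv ?_
    ext v
    simp [polar, Real.cos_add_pi_div_two]
    ring
  · refine ((h0 0).mul (h0 1).sin).congr_fderiv ?_
    ext v
    simp [polar, Real.sin_add_pi_div_two]
    ring

theorem norm_smul_polar_add_smul_polar (a b θ : ℝ) :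
    ‖a • polar 1 θ + b • polar 1 (θ + Real.pi / 2)‖ ^ 2 = a ^ 2 + b ^ 2 := by
  rw [EuclideanSpace.norm_sq_eq, Fin.sum_univ_two]
  simp [polar, Real.cos_add_pi_div_two, Real.sin_add_pi_div_two]
  linear_combination (a ^ 2 + b ^ 2) * Real.cos_sq_add_sin_sq θ

theorem hasDerivAt_along_ray {h : Plane → ℝ} (hh : Differentiable ℝ h) (θ τ : ℝ) :
    HasDerivAt (fun τ => h (τ • e₀ + θ • e₁)) (fderiv ℝ h (τ • e₀ + θ • e₁) e₀) τ := by
  have h1 : HasDerivAt (fun τ : ℝ => τ • e₀ + θ • e₁) e₀ τ := by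
    simpa using ((hasDerivAt_id τ).smul_const e₀).add_const (θ • e₁)
  exact (hh _).hasFDerivAt.comp_hasDerivAt τ h1

section

variable {M : Type*} [MetricSpace M] [ChartedSpace Plane M]
  [RiemannianBundle (fun x : M => TangentSpace 𝓘(ℝ, Plane) x)]
  (F : Plane ≃ₘ⟮𝓘(ℝ, Plane), 𝓘(ℝ, Plane)⟯ M) (θ₀ : ℝ)

theorem pullbackForm_zero_right (Φ : Plane → M) (y u : Plane) : pullbackForm Φ y u 0 = 0 := by
  rw [pullbackForm]
  exact (congrArg (inner ℝ _) (map_zero _)).trans (inner_zero_right _)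

theorem pullbackForm_smul_smul (Φ : Plane → M) (y u : Plane) (c : ℝ) :
    pullbackForm Φ y (c • u) (c • u) = c ^ 2 * pullbackForm Φ y u u := by
  have h : mfderiv 𝓘(ℝ, Plane) 𝓘(ℝ, Plane) Φ y (c • u) =
    c • mfderiv 𝓘(ℝ, Plane) 𝓘(ℝ, Plane) Φ y u := map_smul _ c u
  rw [pullbackForm, h, real_inner_smul_left, real_inner_smul_right, pullbackForm]
  ring

theorem pullbackForm_self_pos {y v : Plane} (hv : v ≠ 0) : 0 < pullbackForm F y v v := by
  have h1 : mfderiv 𝓘(ℝ, Plane) 𝓘(ℝ, Plane) F y v ≠ 0 := by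
    intro h
    apply hv
    have := (F.mfderivToContinuousLinearEquiv (by simp) y).injective (a₁ := v) (a₂ := 0)
    exact this (h.trans (map_zero _).symm)
  exact real_inner_self_pos.2 h1

theorem pullbackForm_comp_polar (y u v : Plane) :
    pullbackForm (fun y : Plane => F (polar (y 0) (y 1))) y u v =
      pullbackForm F (polar (y 0) (y 1))
        (u 0 • polar 1 (y 1) + (y 0 * u 1) • polar 1 (y 1 + Real.pi / 2))
        (v 0 • polar 1 (y 1) + (y 0 * v 1) • polar 1 (y 1 + Real.pi / 2)) := by
  have h := ((F.mdifferentiable (by simp) (polar (y 0) (y 1))).hasMFDerivAt.comp y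
    (hasFDerivAt_polar y).hasMFDerivAt).mfderiv
  have h' (u : Plane) : mfderiv 𝓘(ℝ, Plane) 𝓘(ℝ, Plane)
      (fun y : Plane => F (polar (y 0) (y 1))) y u =
      mfderiv 𝓘(ℝ, Plane) 𝓘(ℝ, Plane) F (polar (y 0) (y 1))
        (u 0 • polar 1 (y 1) + (y 0 * u 1) • polar 1 (y 1 + Real.pi / 2)) := by
    refine (congrArg (fun L => L u) h).trans ?_
    rfl
  rw [pullbackForm, h', h']
  rfl

theorem chartMetric_geodesicPolarChart (y u v : Plane) :
    chartMetric (geodesicPolarChart F θ₀) y u v =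
      pullbackForm F (polar (y 0) (y 1))
        (u 0 • polar 1 (y 1) + (y 0 * u 1) • polar 1 (y 1 + Real.pi / 2))
        (v 0 • polar 1 (y 1) + (y 0 * v 1) • polar 1 (y 1 + Real.pi / 2)) :=
  pullbackForm_comp_polar F y u v

theorem chartMetric_nondegenerate {y : Plane} (hy : 0 < y 0) (u : Plane)
    (hu : chartMetric (geodesicPolarChart F θ₀) y u = 0) : u = 0 := by
  have h1 : chartMetric (geodesicPolarChart F θ₀) y u u = 0 := by simp [hu]
  rw [chartMetric_geodesicPolarChart] at h1
  have h2 : u 0 • polar 1 (y 1) + (y 0 * u 1) • polar 1 (y 1 + Real.pi / 2) = 0 := by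
    by_contra h
    exact (pullbackForm_self_pos F h).ne' h1
  have h3 := norm_smul_polar_add_smul_polar (u 0) (y 0 * u 1) (y 1)
  rw [h2, norm_zero] at h3
  have h4 : u 0 = 0 := by nlinarith [sq_nonneg (u 0), sq_nonneg (y 0 * u 1)]
  have h5 : y 0 * u 1 = 0 := by nlinarith [sq_nonneg (u 0), sq_nonneg (y 0 * u 1)]
  ext i
  fin_cases i
  · simpa using h4
  · simpa [hy.ne'] using h5

theorem chartMetric_symm (φ : OpenPartialHomeomorph M Plane) (y u v : Plane) :
    chartMetric φ y u v = chartMetric φ y v u := by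
  rw [chartMetric_apply, chartMetric_apply, pullbackForm, pullbackForm]
  exact real_inner_comm _ _

variable [IsManifold 𝓘(ℝ, Plane) ∞ M]

theorem christoffel_radial {F : Plane ≃ₘ⟮𝓘(ℝ, Plane), 𝓘(ℝ, Plane)⟯ M} (hF : IsGeodesicPolar F) {τ θ : ℝ} (hτ : 0 < τ) :
    CoordMetric.christoffel (chartMetric (geodesicPolarChart F θ₀)) (τ • e₀ + θ • e₁) e₀ e₀ = 0 := by
  -- The chart enters `chartMetric` only through its inverse `F ∘ polar`, which does not involve the
  -- base angle. The chart centred at `θ` may therefore be used, and its source contains the ray.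
  change CoordMetric.christoffel (chartMetric (geodesicPolarChart F θ)) _ e₀ e₀ = 0
  have hsrc := mem_source_of_pos F θ hτ
  have hgeo := (hF.geodesic_rays θ).2 _ (geodesicPolarChart_mem_maximalAtlas F θ) τ hsrc
  have hev : (fun t => geodesicPolarChart F θ (F (polar t θ))) =ᶠ[𝓝 τ]
      fun t => t • e₀ + θ • e₁ := by
    filter_upwards [lt_mem_nhds hτ] with t ht using geodesicPolarChart_apply_polar_of_pos F θ ht
  have hd (t : ℝ) : deriv (fun t : ℝ => t • e₀ + θ • e₁) t = e₀ := by
    simpa using (((hasDerivAt_id t).smul_const e₀).add_const (θ • e₁)).deriv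
  have hdd : deriv (deriv fun t => geodesicPolarChart F θ (F (polar t θ))) τ = 0 := by
    rw [hev.deriv.deriv_eq, show (deriv fun t : ℝ => t • e₀ + θ • e₁) = fun _ => e₀ from funext hd]
    simp
  rw [hdd, hev.deriv_eq, hd, geodesicPolarChart_apply_polar_of_pos F θ hτ, zero_add] at hgeo
  exact hgeo

variable [IsContMDiffRiemannianBundle 𝓘(ℝ, Plane) ∞ Plane (fun x : M => TangentSpace 𝓘(ℝ, Plane) x)]

/-- The inverse chart is `F ∘ polar`, which is smooth on the whole plane; so the form is smooth
across `s = 0` even though it degenerates there. This permits starting at the pole in the arguments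
below. -/
theorem contDiff_chartMetric : ContDiff ℝ ∞ (chartMetric (geodesicPolarChart F θ₀)) := by
  rw [contDiff_clm_apply_iff]
  intro u
  rw [contDiff_clm_apply_iff]
  intro v
  exact contDiff_pullbackForm (contMDiff_comp_polar F) contDiff_const contDiff_const

theorem contDiff_chartMetric_apply (u v : Plane) :
    ContDiff ℝ ∞ fun y => chartMetric (geodesicPolarChart F θ₀) y u v :=
  contDiff_pullbackForm (contMDiff_comp_polar F) contDiff_const contDiff_const

variable {F}

/-- As rays are geodesics, `∂₀ g(e₀, e₀)` equals half of itself, hence vanishes for `s > 0`. The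
value at the pole is `1` by `isometric_at_pole`, and the mean value theorem carries it along the
ray. -/
theorem chartMetric_radial (hF : IsGeodesicPolar F) {τ θ : ℝ} (hτ : 0 < τ) :
    chartMetric (geodesicPolarChart F θ₀) (τ • e₀ + θ • e₁) e₀ e₀ = 1 := by
  set a : ℝ → ℝ := fun τ => chartMetric (geodesicPolarChart F θ₀) (τ • e₀ + θ • e₁) e₀ e₀ with ha
  have hd (t : ℝ) := hasDerivAt_along_ray
    ((contDiff_chartMetric_apply F θ₀ e₀ e₀).differentiable (by simp)) θ t
  have hd0 {t : ℝ} (ht : 0 < t) : HasDerivAt a 0 t := by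
    have h := CoordMetric.fderiv_of_christoffel_eq_zero
      ((contDiff_chartMetric F θ₀).differentiable (by simp) (t • e₀ + θ • e₁))
      (chartMetric_nondegenerate F θ₀ (by simpa using ht)) (christoffel_radial θ₀ hF ht) e₀
    refine (hd t).congr_deriv ?_
    linarith
  have h0 : a 0 = 1 := by
    have h1 : ‖polar 1 θ‖ = 1 := by rw [norm_polar]; simp
    have h2 := hF.isometric_at_pole (polar 1 θ)
    have h3 : polar 0 θ = 0 := by ext i; fin_cases i <;> simp [polar]
    have h4 : a 0 = pullbackForm F 0 (polar 1 θ) (polar 1 θ) := by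
      simp [ha, chartMetric_geodesicPolarChart, h3]
    rw [h4, pullbackForm, real_inner_self_eq_norm_sq, h2, h1, one_pow]
  obtain ⟨c, hc, hc'⟩ := exists_deriv_eq_slope a hτ (fun t _ => (hd t).continuousAt.continuousWithinAt)
    (fun t ht => (hd0 ht.1).differentiableAt.differentiableWithinAt)
  rw [(hd0 hc.1).deriv, sub_zero, eq_comm, div_eq_zero_iff, or_iff_left hτ.ne', sub_eq_zero, h0]
    at hc'
  exact hc'

/-- The geodesic equation gives `∂₀ g(e₀, e₁) = ½ ∂₁ g(e₀, e₀)`, which is zero by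
`chartMetric_radial`; at the pole the angular field itself vanishes. -/
theorem chartMetric_ortho (hF : IsGeodesicPolar F) {τ θ : ℝ} (hτ : 0 < τ) :
    chartMetric (geodesicPolarChart F θ₀) (τ • e₀ + θ • e₁) e₀ e₁ = 0 := by
  set a : ℝ → ℝ := fun τ => chartMetric (geodesicPolarChart F θ₀) (τ • e₀ + θ • e₁) e₀ e₁ with ha
  have hd (t : ℝ) := hasDerivAt_along_ray
    ((contDiff_chartMetric_apply F θ₀ e₀ e₁).differentiable (by simp)) θ t
  have hd0 {t : ℝ} (ht : 0 < t) : HasDerivAt a 0 t := by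
    have h := CoordMetric.fderiv_of_christoffel_eq_zero
      ((contDiff_chartMetric F θ₀).differentiable (by simp) (t • e₀ + θ • e₁))
      (chartMetric_nondegenerate F θ₀ (by simpa using ht)) (christoffel_radial θ₀ hF ht) e₁
    refine (hd t).congr_deriv ?_
    have hconst : (fun y => chartMetric (geodesicPolarChart F θ₀) y e₀ e₀)
        =ᶠ[𝓝 (t • e₀ + θ • e₁)] fun _ => 1 := by
      have ho : IsOpen {y : Plane | 0 < y 0} :=
        isOpen_lt continuous_const (EuclideanSpace.proj (𝕜 := ℝ) 0).continuous
      filter_upwards [ho.mem_nhds (by simpa using ht)] with y hy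
      rw [CoordMetric.plane_eq y]
      exact chartMetric_radial θ₀ hF hy
    rw [h, hconst.fderiv_eq]
    simp
  have h0 : a 0 = 0 := by
    simp [ha, chartMetric_geodesicPolarChart, pullbackForm_zero_right]
  obtain ⟨c, hc, hc'⟩ := exists_deriv_eq_slope a hτ (fun t _ => (hd t).continuousAt.continuousWithinAt)
    (fun t ht => (hd0 ht.1).differentiableAt.differentiableWithinAt)
  rw [(hd0 hc.1).deriv, sub_zero, eq_comm, div_eq_zero_iff, or_iff_left hτ.ne', sub_eq_zero, h0]
    at hc'
  exact hc'

/-- The Gauss lemma: the metric is `ds² + G dθ²` in geodesic polar coordinates. -/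
theorem isPolarFormAt_chartMetric (hF : IsGeodesicPolar F) {y : Plane} (hy : 0 < y 0) :
    CoordMetric.IsPolarFormAt (chartMetric (geodesicPolarChart F θ₀)) y where
  contDiffAt := (contDiff_chartMetric F θ₀).contDiffAt
  symm := chartMetric_symm _ y
  radial := by rw [CoordMetric.plane_eq y]; exact chartMetric_radial θ₀ hF hy
  ortho := by rw [CoordMetric.plane_eq y]; exact chartMetric_ortho θ₀ hF hy
  pos := by
    rw [chartMetric_geodesicPolarChart]
    apply pullbackForm_self_pos
    rw [← norm_ne_zero_iff, ← pow_ne_zero_iff two_ne_zero, norm_smul_polar_add_smul_polar]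
    simpa using hy.ne'

theorem eventually_isPolarFormAt_chartMetric (hF : IsGeodesicPolar F) {y : Plane} (hy : 0 < y 0) :
    ∀ᶠ y' in 𝓝 y, CoordMetric.IsPolarFormAt (chartMetric (geodesicPolarChart F θ₀)) y' := by
  have ho : IsOpen {y : Plane | 0 < y 0} :=
    isOpen_lt continuous_const (EuclideanSpace.proj (𝕜 := ℝ) 0).continuous
  filter_upwards [ho.mem_nhds hy] with y' hy' using isPolarFormAt_chartMetric θ₀ hF hy'

end

/-! ### Sturm comparison with the hyperbolic sine. -/

section Sturm

variable {f f' f'' : ℝ → ℝ} {k : ℝ}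

/-- This is the Wronskian of `f` with `sinh (k t)`, the solution of `y'' = k² y` that vanishes at
`0`. -/
theorem hasDerivAt_sturm_wronskian (hf : ∀ t, HasDerivAt f (f' t) t)
    (hf' : ∀ t, HasDerivAt f' (f'' t) t) (t : ℝ) :
    HasDerivAt (fun t => f' t * Real.sinh (k * t) - k * f t * Real.cosh (k * t))
      ((f'' t - k ^ 2 * f t) * Real.sinh (k * t)) t := by
  have hk : HasDerivAt (fun t : ℝ => k * t) k t := by simpa using (hasDerivAt_id t).const_mul k
  refine (((hf' t).mul hk.sinh).sub (((hf t).const_mul k).mul hk.cosh)).congr_deriv ?_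
  ring

/-- The Wronskian is zero at `0` and strictly decreasing on `[0, ∞)`. No sign of `f` is used, so the
opposite inequality follows by passing to `-f`. -/
theorem sturm_lt (hk : 0 < k) (hf : ∀ t, HasDerivAt f (f' t) t)
    (hf' : ∀ t, HasDerivAt f' (f'' t) t) (h0 : f 0 = 0)
    (h : ∀ t, 0 < t → f'' t < k ^ 2 * f t) {t : ℝ} (ht : 0 < t) :
    f' t * Real.sinh (k * t) < k * f t * Real.cosh (k * t) := by
  have hd := hasDerivAt_sturm_wronskian (k := k) hf hf'
  have hanti := strictAntiOn_of_deriv_neg (convex_Ici (0 : ℝ))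
    (fun t _ => (hd t).continuousAt.continuousWithinAt) fun t ht => by
      rw [interior_Ici, mem_Ioi] at ht
      rw [(hd t).deriv]
      exact mul_neg_of_neg_of_pos (sub_neg.2 (h t ht)) (Real.sinh_pos_iff.2 (mul_pos hk ht))
  have := hanti self_mem_Ici ht.le ht
  simpa [h0] using this

theorem lt_sturm (hk : 0 < k) (hf : ∀ t, HasDerivAt f (f' t) t)
    (hf' : ∀ t, HasDerivAt f' (f'' t) t) (h0 : f 0 = 0)
    (h : ∀ t, 0 < t → k ^ 2 * f t < f'' t) {t : ℝ} (ht : 0 < t) :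
    k * f t * Real.cosh (k * t) < f' t * Real.sinh (k * t) := by
  have := sturm_lt (f := fun t => -f t) (f' := fun t => -f' t) (f'' := fun t => -f'' t) hk
    (fun t => (hf t).neg) (fun t => (hf' t).neg) (by simp [h0])
    (fun t ht => by linarith [h t ht]) ht
  linarith

end Sturm

/-! ### The Jacobi equation and the bounds on `f'/f`. -/

section

variable {M : Type*} [MetricSpace M] [ChartedSpace Plane M]
  [RiemannianBundle (fun x : M => TangentSpace 𝓘(ℝ, Plane) x)]
  [IsManifold 𝓘(ℝ, Plane) ∞ M]
  [IsContMDiffRiemannianBundle 𝓘(ℝ, Plane) ∞ Plane (fun x : M => TangentSpace 𝓘(ℝ, Plane) x)]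
  {F : Plane ≃ₘ⟮𝓘(ℝ, Plane), 𝓘(ℝ, Plane)⟯ M}

/-- The Jacobi equation: in geodesic polar coordinates `ds² + f² dθ²` one has `f'' = -K f`. -/
theorem exists_jacobi (hF : IsGeodesicPolar F) (θ : ℝ) :
    ∃ f f' f'' : ℝ → ℝ, (∀ t, HasDerivAt f (f' t) t) ∧ (∀ t, HasDerivAt f' (f'' t) t) ∧
      f 0 = 0 ∧ ∀ t, 0 < t → 0 < f t ∧
        gaussCurvature (geodesicPolarChart F θ) (F (polar t θ)) = -f'' t / f t ∧
        fderiv ℝ (fun y => chartMetric (geodesicPolarChart F θ) y e₁ e₁) (t • e₀ + θ • e₁) e₀ /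
          (2 * chartMetric (geodesicPolarChart F θ) (t • e₀ + θ • e₁) e₁ e₁) = f' t / f t := by
  set g := chartMetric (geodesicPolarChart F θ) with hg
  have hν : polar 1 (θ + Real.pi / 2) ≠ 0 := by
    rw [← norm_ne_zero_iff, norm_polar]; simp
  set m : ℝ → ℝ := fun t => pullbackForm F (polar t θ) (polar 1 (θ + Real.pi / 2))
    (polar 1 (θ + Real.pi / 2)) with hm
  have hm0 (t : ℝ) : 0 < m t := pullbackForm_self_pos F hν
  have hray : ContDiff ℝ ∞ fun t : ℝ => t • e₀ + θ • e₁ :=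
    (contDiff_id.smul contDiff_const).add contDiff_const
  have hmc : ContDiff ℝ ∞ m := by
    have h := (contDiff_pullbackForm F.contMDiff
      (U := fun _ => polar 1 (θ + Real.pi / 2)) (V := fun _ => polar 1 (θ + Real.pi / 2))
      contDiff_const contDiff_const).comp (contDiff_polar.comp hray)
    simpa [Function.comp_def, hm] using h
  -- Taking `√G` directly would give `|t| √m`, which is not smooth at `0`. As `m > 0` everywhere, `t
  -- √m` is smooth on all of `ℝ`, and its square is `G` along the ray.
  set f : ℝ → ℝ := fun t => t * Real.sqrt (m t) with hf
  have hfc : ContDiff ℝ ∞ f := contDiff_id.mul (hmc.sqrt fun t => (hm0 t).ne')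
  have hfd (t : ℝ) : HasDerivAt f (deriv f t) t :=
    (hfc.differentiable (by simp) t).hasDerivAt
  have hfdd (t : ℝ) : HasDerivAt (deriv f) (deriv (deriv f) t) t :=
    (((contDiff_infty_iff_deriv.1 hfc).2).differentiable (by simp) t).hasDerivAt
  have hG (t : ℝ) : g (t • e₀ + θ • e₁) e₁ e₁ = f t ^ 2 := by
    have h1 : g (t • e₀ + θ • e₁) e₁ e₁ = pullbackForm F (polar t θ)
        (t • polar 1 (θ + Real.pi / 2)) (t • polar 1 (θ + Real.pi / 2)) := by
      simp [hg, chartMetric_geodesicPolarChart]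
    rw [h1, hf, mul_pow, Real.sq_sqrt (hm0 t).le, pullbackForm_smul_smul]
  have hGs : ContDiff ℝ ∞ fun y => g y e₁ e₁ := contDiff_chartMetric_apply F θ e₁ e₁
  have hG1 (t : ℝ) : fderiv ℝ (fun y => g y e₁ e₁) (t • e₀ + θ • e₁) e₀ = 2 * f t * deriv f t := by
    have h1 := hasDerivAt_along_ray (hGs.differentiable (by simp)) θ t
    simp only [hG] at h1
    refine h1.unique (((hfd t).pow 2).congr_deriv ?_)
    simp
  have hG2 (t : ℝ) : fderiv ℝ (fun y => fderiv ℝ (fun y => g y e₁ e₁) y e₀) (t • e₀ + θ • e₁) e₀ =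
      2 * (deriv f t * deriv f t + f t * deriv (deriv f) t) := by
    have h1 := hasDerivAt_along_ray (h := fun y => fderiv ℝ (fun y => g y e₁ e₁) y e₀)
      (((hGs.fderiv_right (m := 1) (by norm_cast)).differentiable (by simp)).clm_apply
        (differentiable_const _)) θ t
    simp only [hG1] at h1
    refine h1.unique ((((hfd t).const_mul 2).mul (hfdd t)).congr_deriv ?_)
    ring
  refine ⟨f, deriv f, deriv (deriv f), hfd, hfdd, by simp [hf], fun t ht => ?_⟩
  have hft : 0 < f t := mul_pos ht (Real.sqrt_pos.2 (hm0 t))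
  refine ⟨hft, ?_, ?_⟩
  · rw [gaussCurvature, geodesicPolarChart_apply_polar_of_pos F θ ht, CoordMetric.IsPolarFormAt.sectionalCurvature_eq
      (eventually_isPolarFormAt_chartMetric θ hF (by simpa using ht)), ← hg, hG1, hG2, hG]
    field_simp
    ring
  · rw [hG1, hG]
    field_simp

theorem logDeriv_lt_of_curvature {k : ℝ} (hk : 0 < k) (hF : IsGeodesicPolar F)
    (hK : GaussCurvatureSatisfies M fun κ => -k ^ 2 < κ) (θ : ℝ) {t : ℝ} (ht : 0 < t) :
    fderiv ℝ (fun y => chartMetric (geodesicPolarChart F θ) y e₁ e₁) (t • e₀ + θ • e₁) e₀ /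
      (2 * chartMetric (geodesicPolarChart F θ) (t • e₀ + θ • e₁) e₁ e₁) <
        k * Real.cosh (k * t) / Real.sinh (k * t) := by
  obtain ⟨f, f', f'', hf, hf', h0, h⟩ := exists_jacobi hF θ
  rw [(h t ht).2.2, div_lt_div_iff₀ (h t ht).1 (Real.sinh_pos_iff.2 (mul_pos hk ht))]
  have := sturm_lt hk hf hf' h0 (fun t ht => ?_) ht
  · linarith
  · have h1 := hK _ (geodesicPolarChart_mem_maximalAtlas F θ) (F (polar t θ))
      (mem_source_of_pos F θ ht)
    rw [(h t ht).2.1, lt_div_iff₀ (h t ht).1] at h1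
    linarith

theorem lt_logDeriv_of_curvature {k : ℝ} (hk : 0 < k) (hF : IsGeodesicPolar F)
    (hK : GaussCurvatureSatisfies M fun κ => κ < -k ^ 2) (θ : ℝ) {t : ℝ} (ht : 0 < t) :
    k * Real.cosh (k * t) / Real.sinh (k * t) <
      fderiv ℝ (fun y => chartMetric (geodesicPolarChart F θ) y e₁ e₁) (t • e₀ + θ • e₁) e₀ /
        (2 * chartMetric (geodesicPolarChart F θ) (t • e₀ + θ • e₁) e₁ e₁) := by
  obtain ⟨f, f', f'', hf, hf', h0, h⟩ := exists_jacobi hF θ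
  rw [(h t ht).2.2, div_lt_div_iff₀ (Real.sinh_pos_iff.2 (mul_pos hk ht)) (h t ht).1]
  have := lt_sturm hk hf hf' h0 (fun t ht => ?_) ht
  · linarith
  · have h1 := hK _ (geodesicPolarChart_mem_maximalAtlas F θ) (F (polar t θ))
      (mem_source_of_pos F θ ht)
    rw [(h t ht).2.1, div_lt_iff₀ (h t ht).1] at h1
    linarith

end

/-! ### The annulus separates `M × ℝ` into two sides. -/

section

variable {M : Type*} [MetricSpace M] [ChartedSpace Plane M]
  (F : Plane ≃ₘ⟮𝓘(ℝ, Plane), 𝓘(ℝ, Plane)⟯ M) {A k : ℝ}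

/-- The points of `M × ℝ` that the annulus separates from its axis. -/
def outside (A k : ℝ) : Set (M × ℝ) :=
  {x | ∃ u, x.2 = meridianHeight A k u ∧ meridianRadius A k u < ‖F.symm x.1‖}

/-- The points of `M × ℝ` on the side of the axis of the annulus. -/
def inside (A k : ℝ) : Set (M × ℝ) :=
  {x | ∀ u, x.2 = meridianHeight A k u → ‖F.symm x.1‖ < meridianRadius A k u}

/-- The radius is even and the height odd in `u`, so the two signs `(-1) ^ j` amount to the two
signs of `u`. -/
theorem mem_catenoid_iff [RiemannianBundle (fun x : M => TangentSpace 𝓘(ℝ, Plane) x)]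
    (hA : 0 < A) (hk : 0 < k) {x : M × ℝ} :
    x ∈ catenoid F A k ↔
      ∃ u, x.2 = meridianHeight A k u ∧ ‖F.symm x.1‖ = meridianRadius A k u := by
  constructor
  · rintro ⟨s, θ, hs, j, rfl⟩
    obtain ⟨u, hu, rfl⟩ := exists_meridianRadius_eq hA hk hs
    rw [profile_meridianRadius hA hk hu]
    have hn : ‖F.symm (F (polar (meridianRadius A k u) θ))‖ = meridianRadius A k u := by
      rw [F.symm_apply_apply, norm_polar, abs_of_pos (meridianRadius_pos hA hk u)]
    fin_cases j
    · exact ⟨u, by simp, hn⟩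
    · exact ⟨-u, by simp [meridianHeight_neg], by rw [meridianRadius_neg]; exact hn⟩
  · rintro ⟨u, h1, h2⟩
    refine ⟨meridianRadius A k u, 0 + Complex.arg (rotateToComplex 0 (F.symm x.1)),
      neckRadius_le_meridianRadius hA hk u, if 0 ≤ u then 0 else 1, ?_⟩
    rw [← h2, polar_norm_arg, F.apply_symm_apply, h2, ← meridianRadius_abs,
      profile_meridianRadius hA hk (abs_nonneg u)]
    ext1
    · rfl
    · rw [h1]
      split_ifs with hu
      · simp [abs_of_nonneg hu]
      · simp [abs_of_neg (not_le.1 hu), meridianHeight_neg]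

theorem mem_catenoid_iff_exists_polar [RiemannianBundle (fun x : M => TangentSpace 𝓘(ℝ, Plane) x)]
    (hA : 0 < A) (hk : 0 < k) {x : M × ℝ} :
    x ∈ catenoid F A k ↔
      ∃ u θ, x = (F (polar (meridianRadius A k u) θ), meridianHeight A k u) := by
  rw [mem_catenoid_iff F hA hk]
  constructor
  · rintro ⟨u, h1, h2⟩
    refine ⟨u, 0 + Complex.arg (rotateToComplex 0 (F.symm x.1)), ?_⟩
    rw [← h1, ← h2, polar_norm_arg, F.apply_symm_apply]
  · rintro ⟨u, θ, rfl⟩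
    refine ⟨u, rfl, ?_⟩
    rw [F.symm_apply_apply, norm_polar, abs_of_pos (meridianRadius_pos hA hk u)]

theorem isOpenMap_meridianHeight (hA : 0 < A) (hk : 0 < k) : IsOpenMap (meridianHeight A k) :=
  isOpenMap_of_hasStrictDerivAt
    (fun u => (contDiff_meridianSlope A hk).continuous.integral_hasStrictDerivAt 0 u)
    fun u => (meridianSlope_pos hA hk u).ne'

/-- The set is the image of an open set of pairs `(q, u)` under `id` times the height, and the
height is an open map. -/
theorem isOpen_outside (hA : 0 < A) (hk : 0 < k) : IsOpen (outside F A k) := by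
  have h1 : IsOpen {x : M × ℝ | meridianRadius A k x.2 < ‖F.symm x.1‖} :=
    isOpen_lt ((contDiff_meridianRadius A k).continuous.comp continuous_snd)
      (F.symm.continuous.comp continuous_fst).norm
  convert (IsOpenMap.id.prodMap (isOpenMap_meridianHeight hA hk)) _ h1 using 1
  ext x
  constructor
  · rintro ⟨u, h2, h3⟩
    exact ⟨(x.1, u), h3, by ext1 <;> simp [h2]⟩
  · rintro ⟨y, hy, rfl⟩
    exact ⟨y.2, rfl, hy⟩

/-- The radius is proper: `|u| ≤ cosh u = sinh (k s) / A`, where `s` is the radius at `u`. -/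
theorem isCompact_meridianRadius_le (hA : 0 < A) (hk : 0 < k) (C : ℝ) :
    IsCompact {u | meridianRadius A k u ≤ C} := by
  apply Metric.isCompact_of_isClosed_isBounded
  · exact isClosed_le (contDiff_meridianRadius A k).continuous continuous_const
  · refine (Metric.isBounded_Icc (-(Real.sinh (k * C) / A)) (Real.sinh (k * C) / A)).subset
      fun u hu => ?_
    rw [mem_Icc, ← abs_le, le_div_iff₀ hA]
    have h1 : A * Real.cosh u ≤ Real.sinh (k * C) := by
      rw [← sinh_meridianRadius hk, Real.sinh_le_sinh]
      exact mul_le_mul_of_nonneg_left hu hk.le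
    have h2 : |u| ≤ Real.cosh u := by
      rw [← Real.cosh_abs]
      exact (Real.self_le_sinh_iff.2 (abs_nonneg u)).trans (Real.sinh_lt_cosh _).le
    nlinarith

/-- Heights that the meridian does not attain belong to this set vacuously, so openness at the
extreme heights needs properness. A bound `C` on the distance to the axis is chosen such that the
heights with meridian radius at most `C` form a compact set missing the given height. -/
theorem isOpen_inside (hA : 0 < A) (hk : 0 < k) : IsOpen (inside F A k) := by
  rw [isOpen_iff_mem_nhds]
  intro x hx
  obtain ⟨C, hC, hxC⟩ : ∃ C, ‖F.symm x.1‖ < C ∧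
      x.2 ∉ meridianHeight A k '' {u | meridianRadius A k u ≤ C} := by
    by_cases h : ∃ u, x.2 = meridianHeight A k u
    · obtain ⟨u, hu⟩ := h
      obtain ⟨C, h1, h2⟩ := exists_between (hx u hu)
      refine ⟨C, h1, ?_⟩
      rintro ⟨v, hv, hvx⟩
      rw [hu, (strictMono_meridianHeight hA hk).injective.eq_iff] at hvx
      subst hvx
      exact absurd hv (not_le.2 h2)
    · refine ⟨‖F.symm x.1‖ + 1, by linarith, ?_⟩
      rintro ⟨v, -, hv⟩
      exact h ⟨v, hv.symm⟩
  have hclosed := ((isCompact_meridianRadius_le hA hk C).image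
    (contDiff_meridianHeight A hk).continuous).isClosed
  have h1 : IsOpen {y : M × ℝ | ‖F.symm y.1‖ < C} :=
    isOpen_lt (F.symm.continuous.comp continuous_fst).norm continuous_const
  filter_upwards [h1.mem_nhds hC,
    (hclosed.isOpen_compl.preimage continuous_snd).mem_nhds hxC] with y hy hy' u hu
  refine lt_of_lt_of_le hy (not_lt.1 fun h => hy' ⟨u, h.le, hu.symm⟩)

/-- Each point moves radially to the axis at its own height without leaving the set, and the whole
axis lies in the set. -/
theorem isPreconnected_inside (hA : 0 < A) (hk : 0 < k) : IsPreconnected (inside F A k) := by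
  have haxis (t : ℝ) : (F 0, t) ∈ inside F A k := fun u _ => by
    rw [F.symm_apply_apply, norm_zero]
    exact meridianRadius_pos hA hk u
  refine isPreconnected_of_forall (F 0, 0) fun x hx =>
    ⟨(fun c : ℝ => (F (c • F.symm x.1), x.2)) '' Icc 0 1 ∪ range fun t : ℝ => (F 0, t),
      ?_, ?_, ?_, ?_⟩
  · rintro _ (⟨c, hc, rfl⟩ | ⟨t, rfl⟩)
    · intro u hu
      rw [F.symm_apply_apply, norm_smul, Real.norm_of_nonneg hc.1]
      exact (mul_le_of_le_one_left (norm_nonneg _) hc.2).trans_lt (hx u hu)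
    · exact haxis t
  · exact Or.inr ⟨0, rfl⟩
  · exact Or.inl ⟨1, by simp, by simp⟩
  · refine IsPreconnected.union (F 0, x.2) ⟨0, by simp, by simp⟩ ⟨x.2, rfl⟩ ?_ ?_
    · refine isPreconnected_Icc.image _ (Continuous.continuousOn ?_)
      exact (F.continuous.comp (continuous_id.smul continuous_const)).prodMk continuous_const
    · exact isPreconnected_range (continuous_const.prodMk continuous_id)

theorem disjoint_inside_outside : Disjoint (inside F A k) (outside F A k) := by
  rw [Set.disjoint_left]
  rintro x hx ⟨u, hu, hu'⟩
  exact lt_asymm hu' (hx u hu)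

variable [RiemannianBundle (fun x : M => TangentSpace 𝓘(ℝ, Plane) x)]

theorem compl_catenoid (hA : 0 < A) (hk : 0 < k) :
    (catenoid F A k)ᶜ = inside F A k ∪ outside F A k := by
  ext x
  rw [mem_compl_iff, mem_catenoid_iff F hA hk]
  constructor
  · intro h
    by_cases h' : x ∈ outside F A k
    · exact Or.inr h'
    · refine Or.inl fun u hu => lt_of_le_of_ne (not_lt.1 fun h1 => h' ⟨u, hu, h1⟩) fun h1 => ?_
      exact h ⟨u, hu, h1⟩
  · rintro (h | ⟨u, hu, hu'⟩) ⟨v, hv, hv'⟩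
    · exact (h v hv).ne hv'
    · rw [hu, (strictMono_meridianHeight hA hk).injective.eq_iff] at hv
      subst hv
      exact hu'.ne' hv'

theorem inside_subset_innerRegion (hA : 0 < A) (hk : 0 < k) :
    inside F A k ⊆ innerRegion (catenoid F A k) := by
  intro x hx
  have hsub : inside F A k ⊆ (catenoid F A k)ᶜ := by
    rw [compl_catenoid F hA hk]; exact subset_union_left
  refine ⟨hsub hx, Real.pi / (2 * k) + 1, ?_⟩
  refine Subset.trans ?_ ((isPreconnected_inside F hA hk).subset_connectedComponentIn hx hsub)
  rintro ⟨q, t⟩ ⟨-, ht⟩ u hu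
  -- Above the bound on the height the condition defining `inside` is vacuous.
  exact absurd hu (ne_of_gt ((meridianHeight_lt hk hA u).trans ht))

/-- A component containing a half space contains a point of the axis, which lies in `inside`; if it
also met `outside`, the two disjoint open sets would disconnect it. -/
theorem outside_subset_outerRegion (hA : 0 < A) (hk : 0 < k) :
    outside F A k ⊆ outerRegion (catenoid F A k) := by
  intro x hx
  have hxc : x ∈ (catenoid F A k)ᶜ := by
    rw [compl_catenoid F hA hk]; exact Or.inr hx
  refine ⟨hxc, ?_⟩
  rintro ⟨-, T, hT⟩
  have hy : (F 0, T + 1) ∈ connectedComponentIn (catenoid F A k)ᶜ x :=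
    hT ⟨mem_univ _, by simp⟩
  have hy' : (F 0, T + 1) ∈ inside F A k := fun u _ => by
    rw [F.symm_apply_apply, norm_zero]
    exact meridianRadius_pos hA hk u
  obtain ⟨z, -, hz, hz'⟩ := isPreconnected_connectedComponentIn (inside F A k) (outside F A k)
    (isOpen_inside F hA hk) (isOpen_outside F hA hk)
    ((connectedComponentIn_subset _ _).trans (compl_catenoid F hA hk).le)
    ⟨_, hy, hy'⟩ ⟨x, mem_connectedComponentIn hxc, hx⟩
  exact (disjoint_inside_outside F).le_bot ⟨hz, hz'⟩

end

/-! ### The annulus as an embedded surface. -/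

/-- A local inverse of the height of the meridian. -/
theorem exists_localInverse_meridianHeight {A k : ℝ} (hA : 0 < A) (hk : 0 < k) (u₀ : ℝ) :
    ∃ ι : ℝ → ℝ, HasDerivAt ι (meridianSlope A k u₀)⁻¹ (meridianHeight A k u₀) ∧
      ι (meridianHeight A k u₀) = u₀ ∧
      ∀ᶠ t in 𝓝 (meridianHeight A k u₀), meridianHeight A k (ι t) = t := by
  have h : HasStrictDerivAt (meridianHeight A k) (meridianSlope A k u₀) u₀ :=
    (contDiff_meridianSlope A hk).continuous.integral_hasStrictDerivAt 0 u₀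
  have h0 := (meridianSlope_pos hA hk u₀).ne'
  refine ⟨h.localInverse _ _ _ h0, (h.to_localInverse h0).hasDerivAt, ?_, ?_⟩
  · exact (h.hasStrictFDerivAt_equiv h0).localInverse_apply_image
  · exact (h.hasStrictFDerivAt_equiv h0).eventually_right_inverse

section

variable {M : Type*} [MetricSpace M] [ChartedSpace Plane M]
  (F : Plane ≃ₘ⟮𝓘(ℝ, Plane), 𝓘(ℝ, Plane)⟯ M) {A k : ℝ} (u₀ θ₀ : ℝ)

/-- The parametrization of the annulus by the parameter of the meridian and the angle. -/
def annulus (A k u₀ θ₀ : ℝ) (w : Plane) : M × ℝ :=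
  (F (polar (meridianRadius A k (u₀ + w 0)) (θ₀ + w 1)), meridianHeight A k (u₀ + w 0))

theorem annulus_zero : annulus F A k u₀ θ₀ 0 =
    (F (polar (meridianRadius A k u₀) θ₀), meridianHeight A k u₀) := by
  simp [annulus]

theorem contDiff_revolution {s z : ℝ → ℝ} (hs : ContDiff ℝ ∞ s) (hz : ContDiff ℝ ∞ z) :
    ContDiff ℝ ∞ (CoordMetric.revolution s z u₀ θ₀) := by
  have h (c : ℝ) (i : Fin 2) : ContDiff ℝ ∞ fun w : Plane => c + w i :=
    contDiff_const.add (EuclideanSpace.proj (𝕜 := ℝ) i).contDiff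
  exact (((hs.comp (h u₀ 0)).smul contDiff_const).add ((h θ₀ 1).smul contDiff_const)).prodMk
    (hz.comp (h u₀ 0))

theorem annulus_eq (w : Plane) : annulus F A k u₀ θ₀ w =
    (F (polar ((CoordMetric.revolution (meridianRadius A k) (meridianHeight A k) u₀ θ₀ w).1 0)
      ((CoordMetric.revolution (meridianRadius A k) (meridianHeight A k) u₀ θ₀ w).1 1)),
      (CoordMetric.revolution (meridianRadius A k) (meridianHeight A k) u₀ θ₀ w).2) := by
  simp [annulus, CoordMetric.revolution]

theorem contMDiff_annulus (hk : 0 < k) :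
    ContMDiff 𝓘(ℝ, Plane) prodModel ∞ (annulus F A k u₀ θ₀) := by
  have h := contDiff_revolution u₀ θ₀ (contDiff_meridianRadius A k) (contDiff_meridianHeight A hk)
  rw [show annulus F A k u₀ θ₀ = _ from funext (annulus_eq F u₀ θ₀)]
  exact ((contMDiff_comp_polar F).comp h.fst.contMDiff).prodMk h.snd.contMDiff

theorem eventually_chart_annulus (hA : 0 < A) (hk : 0 < k) :
    (fun w => (geodesicPolarChart F θ₀ (annulus F A k u₀ θ₀ w).1, (annulus F A k u₀ θ₀ w).2))
      =ᶠ[𝓝 0] CoordMetric.revolution (meridianRadius A k) (meridianHeight A k) u₀ θ₀ := by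
  have h1 : ∀ᶠ w : Plane in 𝓝 0, w 1 ∈ Ioo (-Real.pi) Real.pi := by
    have hc : ContinuousAt (fun w : Plane => w 1) 0 :=
      (EuclideanSpace.proj (𝕜 := ℝ) 1).continuous.continuousAt
    exact hc.eventually_mem (Ioo_mem_nhds (by simp [Real.pi_pos]) (by simp [Real.pi_pos]))
  filter_upwards [h1] with w hw
  rw [annulus_eq]
  ext1
  · apply geodesicPolarChart_apply_polar
    rw [mem_geodesicPolarChart_target]
    simpa [CoordMetric.revolution, meridianRadius_pos hA hk] using hw
  · rfl

theorem geodesicPolarChart_mdifferentiable [IsManifold 𝓘(ℝ, Plane) ∞ M] :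
    (geodesicPolarChart F θ₀).MDifferentiable 𝓘(ℝ, Plane) 𝓘(ℝ, Plane) :=
  ⟨(contMDiffOn_of_mem_maximalAtlas (geodesicPolarChart_mem_maximalAtlas F θ₀)).mdifferentiableOn
      (by simp),
    (contMDiffOn_symm_of_mem_maximalAtlas
      (geodesicPolarChart_mem_maximalAtlas F θ₀)).mdifferentiableOn (by simp)⟩

/-- Naming the differential as a map `L'` between model spaces allows ordinary Fréchet calculus in
place of tangent spaces. -/
theorem hasFDerivAt_chart_comp {E : Type*} [NormedAddCommGroup E] [NormedSpace ℝ E]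
    {φ : OpenPartialHomeomorph M Plane} (hφ : φ.MDifferentiable 𝓘(ℝ, Plane) 𝓘(ℝ, Plane))
    {c : E → M × ℝ} {a : E} {L : E →L[ℝ] Plane × ℝ}
    (hc : HasMFDerivAt 𝓘(ℝ, E) prodModel c a L) (ha : (c a).1 ∈ φ.source) :
    ∃ L' : Plane →L[ℝ] Plane, L' = mfderiv 𝓘(ℝ, Plane) 𝓘(ℝ, Plane) φ (c a).1 ∧
      HasFDerivAt (fun w => φ (c w).1) (L'.comp ((ContinuousLinearMap.fst ℝ Plane ℝ).comp L)) a :=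
  ⟨_, rfl, ((hφ.mdifferentiableAt ha).hasMFDerivAt.comp a ((hasMFDerivAt_fst _).comp a hc)).hasFDerivAt⟩

theorem hasFDerivAt_snd_comp {E : Type*} [NormedAddCommGroup E] [NormedSpace ℝ E]
    {c : E → M × ℝ} {a : E} {L : E →L[ℝ] Plane × ℝ}
    (hc : HasMFDerivAt 𝓘(ℝ, E) prodModel c a L) :
    HasFDerivAt (fun w => (c w).2) ((ContinuousLinearMap.snd ℝ Plane ℝ).comp L) a :=
  ((hasMFDerivAt_snd _).comp a hc).hasFDerivAt

theorem injective_mfderiv_annulus [IsManifold 𝓘(ℝ, Plane) ∞ M] (hA : 0 < A) (hk : 0 < k) :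
    Function.Injective (mfderiv 𝓘(ℝ, Plane) prodModel (annulus F A k u₀ θ₀) 0) := by
  rw [injective_iff_map_eq_zero]
  obtain ⟨L, hL⟩ : ∃ L : Plane →L[ℝ] Plane × ℝ,
      L = mfderiv 𝓘(ℝ, Plane) prodModel (annulus F A k u₀ θ₀) 0 := ⟨_, rfl⟩
  have hX : HasMFDerivAt 𝓘(ℝ, Plane) prodModel (annulus F A k u₀ θ₀) 0 L :=
    hL ▸ ((contMDiff_annulus F u₀ θ₀ hk).mdifferentiable (by simp) 0).hasMFDerivAt
  have hd := CoordMetric.hasFDerivAt_revolution (w := 0) (θ₀ := θ₀)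
    (hasDerivAt_meridianRadius A k (u₀ + (0 : Plane) 0))
    (hasDerivAt_meridianHeight A hk (u₀ + (0 : Plane) 0))
  have hd' := hd.congr_of_eventuallyEq (eventually_chart_annulus F u₀ θ₀ hA hk)
  have hsrc : (annulus F A k u₀ θ₀ 0).1 ∈ (geodesicPolarChart F θ₀).source := by
    rw [annulus_zero]
    exact mem_source_of_pos F θ₀ (meridianRadius_pos hA hk u₀)
  have key (v : Plane) (hv : L v = 0) : v = 0 := by
    have h1 : fderiv ℝ (fun w => geodesicPolarChart F θ₀ (annulus F A k u₀ θ₀ w).1) 0 v = 0 := by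
      obtain ⟨L', -, e⟩ := hasFDerivAt_chart_comp (geodesicPolarChart_mdifferentiable F θ₀) hX hsrc
      rw [e.fderiv]
      simp [hv]
    have h2 : fderiv ℝ (fun w => (annulus F A k u₀ θ₀ w).2) 0 v = 0 := by
      rw [(hasFDerivAt_snd_comp hX).fderiv]
      simp [hv]
    rw [hd'.fst.fderiv] at h1
    rw [hd'.snd.fderiv] at h2
    have h1' : v 1 = 0 := by simpa using congrArg (fun z : Plane => z 1) h1
    have h2' : v 0 = 0 := by simpa [(meridianSlope_pos hA hk _).ne'] using h2
    ext i
    fin_cases i <;> assumption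
  exact fun v hv => key v ((congrArg (fun L : Plane →L[ℝ] Plane × ℝ => L v) hL).trans hv)

/-- The height is strictly monotone along the meridian, so the height and the angle of a point
determine its parameters. The map `L` recovers them continuously, at the neck as well, which makes
the parametrization open onto the annulus. -/
theorem map_nhds_annulus [RiemannianBundle (fun x : M => TangentSpace 𝓘(ℝ, Plane) x)]
    (hA : 0 < A) (hk : 0 < k) :
    Filter.map (annulus F A k u₀ θ₀) (𝓝 0) =
      𝓝[catenoid F A k] (F (polar (meridianRadius A k u₀) θ₀), meridianHeight A k u₀) := by
  have hpos := meridianRadius_pos hA hk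
  apply le_antisymm
  · rw [← annulus_zero]
    refine tendsto_nhdsWithin_iff.2 ⟨(contMDiff_annulus F u₀ θ₀ hk).continuous.continuousAt,
      Eventually.of_forall fun w => ?_⟩
    rw [mem_catenoid_iff F hA hk]
    refine ⟨u₀ + w 0, rfl, ?_⟩
    rw [annulus, F.symm_apply_apply, norm_polar, abs_of_pos (hpos _)]
  · obtain ⟨ι, hι, hι0, hιr⟩ := exists_localInverse_meridianHeight hA hk u₀
    set x : M × ℝ := (F (polar (meridianRadius A k u₀) θ₀), meridianHeight A k u₀) with hx
    set L : M × ℝ → Plane := fun y =>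
      !₂[ι y.2 - u₀, geodesicPolarChart F θ₀ y.1 1 - θ₀] with hL
    have hsrc := mem_source_of_pos F θ₀ (hpos u₀)
    have hφ : ContinuousAt (fun y : M × ℝ => geodesicPolarChart F θ₀ y.1) x :=
      ContinuousAt.comp (f := Prod.fst) (g := geodesicPolarChart F θ₀)
        ((geodesicPolarChart F θ₀).continuousAt hsrc) continuousAt_fst
    have hιc : ContinuousAt (fun y : M × ℝ => ι y.2) x :=
      ContinuousAt.comp (f := Prod.snd) (g := ι) hι.continuousAt continuousAt_snd
    have hLc : ContinuousAt L x := by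
      refine (PiLp.continuous_toLp 2 _).continuousAt.comp (continuousAt_pi.2 fun i => ?_)
      fin_cases i
      · exact hιc.sub continuousAt_const
      · exact ((EuclideanSpace.proj (𝕜 := ℝ) 1).continuous.continuousAt.comp hφ).sub
          continuousAt_const
    have hL0 : L x = 0 := by
      ext i
      fin_cases i
      · simp [hL, hx, hι0]
      · simp [hL, hx, geodesicPolarChart_apply_polar_of_pos F θ₀ (hpos u₀)]
    have hinv : ∀ᶠ y in 𝓝[catenoid F A k] x, annulus F A k u₀ θ₀ (L y) = y := by
      have h1 : ∀ᶠ y : M × ℝ in 𝓝 x, meridianHeight A k (ι y.2) = y.2 :=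
        (continuous_snd.tendsto x).eventually hιr
      have h2 : ∀ᶠ y : M × ℝ in 𝓝 x, y.1 ∈ (geodesicPolarChart F θ₀).source :=
        (continuous_fst.tendsto x).eventually ((geodesicPolarChart F θ₀).open_source.mem_nhds hsrc)
      filter_upwards [nhdsWithin_le_nhds h1, nhdsWithin_le_nhds h2, self_mem_nhdsWithin]
        with y hy1 hy2 hy3
      obtain ⟨u, hu, hu'⟩ := (mem_catenoid_iff F hA hk).1 hy3
      have hιu : ι y.2 = u :=
        (strictMono_meridianHeight hA hk).injective (hy1.trans hu)
      ext1
      · have h3 := (geodesicPolarChart F θ₀).left_inv hy2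
        rw [geodesicPolarChart_symm_apply] at h3
        conv_rhs => rw [← h3]
        simp [annulus, hL, hιu, ← hu', geodesicPolarChart_apply]
      · simp [annulus, hL, hy1]
    intro U hU
    rw [mem_map] at hU
    have h4 : L ⁻¹' (annulus F A k u₀ θ₀ ⁻¹' U) ∈ 𝓝[catenoid F A k] x :=
      nhdsWithin_le_nhds (hLc.preimage_mem_nhds (by rwa [hL0]))
    filter_upwards [h4, hinv] with y hy hy'
    rw [← hy']
    exact hy

theorem isLocalParametrization_annulus [IsManifold 𝓘(ℝ, Plane) ∞ M]
    [RiemannianBundle (fun x : M => TangentSpace 𝓘(ℝ, Plane) x)] (hA : 0 < A) (hk : 0 < k) :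
    IsLocalParametrization (catenoid F A k)
      (F (polar (meridianRadius A k u₀) θ₀), meridianHeight A k u₀) (annulus F A k u₀ θ₀) where
  base := annulus_zero F u₀ θ₀
  smooth := Eventually.of_forall fun w => contMDiff_annulus F u₀ θ₀ hk w
  immersive := injective_mfderiv_annulus F u₀ θ₀ hA hk
  map_nhds := map_nhds_annulus F u₀ θ₀ hA hk

end

/-! ### The mean curvature vector and the side it points to. -/

theorem eventually_pos_of_hasDerivAt {f : ℝ → ℝ} {f' a : ℝ} (hf : HasDerivAt f f' a)
    (h0 : f a = 0) (hf' : 0 < f') : ∀ᶠ t in 𝓝[>] a, 0 < f t := by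
  have h := (hasDerivAt_iff_tendsto_slope.1 hf).eventually (lt_mem_nhds hf')
  have hle : 𝓝[>] a ≤ 𝓝[≠] a := nhdsWithin_mono a fun t ht => ne_of_gt ht
  filter_upwards [hle h, self_mem_nhdsWithin] with t ht hat
  rw [slope_def_field, h0, sub_zero] at ht
  exact (div_pos_iff_of_pos_right (sub_pos.2 hat)).1 ht

section

variable {M : Type*} [MetricSpace M] [ChartedSpace Plane M]
  {F : Plane ≃ₘ⟮𝓘(ℝ, Plane), 𝓘(ℝ, Plane)⟯ M} {A k : ℝ} (u₀ θ₀ : ℝ)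

/-- The first variation of `s(ι(t)) - s` along a curve in `M × ℝ` that starts on the annulus, where
the annulus is the graph `s = s(ι(t))` over its axis. -/
theorem hasDerivAt_defining_function [IsManifold 𝓘(ℝ, Plane) ∞ M] (hA : 0 < A) (hk : 0 < k)
    {ι : ℝ → ℝ} (hι : HasDerivAt ι (meridianSlope A k u₀)⁻¹ (meridianHeight A k u₀))
    (hι0 : ι (meridianHeight A k u₀) = u₀) {x : M × ℝ}
    (hx : x = (F (polar (meridianRadius A k u₀) θ₀), meridianHeight A k u₀))
    {V : Plane × ℝ} {H : TangentSpace prodModel x}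
    (hH : H = ((mfderiv 𝓘(ℝ, Plane) 𝓘(ℝ, Plane) (geodesicPolarChart F θ₀).symm
      (geodesicPolarChart F θ₀ x.1) V.1, V.2) : Plane × ℝ))
    {c : ℝ → M × ℝ} (hc0 : c 0 = x) (hc : MDifferentiableAt 𝓘(ℝ, ℝ) prodModel c 0)
    (hcH : mfderiv 𝓘(ℝ, ℝ) prodModel c 0 (1 : ℝ) = H) :
    HasDerivAt (fun t => meridianRadius A k (ι (c t).2) - ‖F.symm (c t).1‖)
      (Real.sinh u₀ * V.2 - V.1 0) 0 := by
  have hpos := meridianRadius_pos hA hk u₀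
  have hφ := geodesicPolarChart_mdifferentiable F θ₀
  subst hc0
  have hsrc : (c 0).1 ∈ (geodesicPolarChart F θ₀).source := by
    rw [hx]
    exact mem_source_of_pos F θ₀ hpos
  obtain ⟨L, hL⟩ : ∃ L : ℝ →L[ℝ] Plane × ℝ, L = mfderiv 𝓘(ℝ, ℝ) prodModel c 0 := ⟨_, rfl⟩
  have hX : HasMFDerivAt 𝓘(ℝ, ℝ) prodModel c 0 L := hL ▸ hc.hasMFDerivAt
  have hL1 : L 1 = ((mfderiv 𝓘(ℝ, Plane) 𝓘(ℝ, Plane) (geodesicPolarChart F θ₀).symm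
      (geodesicPolarChart F θ₀ (c 0).1) V.1, V.2) : Plane × ℝ) :=
    (congrArg (fun L : ℝ →L[ℝ] Plane × ℝ => L 1) hL).trans (hcH.trans hH)
  obtain ⟨L', hL', hα⟩ := hasFDerivAt_chart_comp hφ hX hsrc
  have hV : L' (L 1).1 = V.1 := by
    rw [hL1, hL']
    exact (hφ.mfderiv hsrc).apply_symm_apply V.1
  -- The norm of `F.symm` is the first coordinate of the geodesic polar chart.
  have hα' : HasDerivAt (fun t => ‖F.symm (c t).1‖) (V.1 0) 0 := by
    have h1 := ((EuclideanSpace.proj (𝕜 := ℝ) (0 : Fin 2)).hasFDerivAt.comp 0 hα).hasDerivAt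
    refine h1.congr_deriv ?_
    simp [hV]
  have hβ : HasDerivAt (fun t => (c t).2) V.2 0 := by
    refine (hasFDerivAt_snd_comp hX).hasDerivAt.congr_deriv ?_
    simp [hL1]
  have hx2 : (c 0).2 = meridianHeight A k u₀ := by rw [hx]
  rw [← hx2] at hι hι0
  have h1 : HasDerivAt (fun t => ι (c t).2) ((meridianSlope A k u₀)⁻¹ * V.2) 0 :=
    HasDerivAt.comp (h₂ := ι) (h := fun t => (c t).2) 0 hι hβ
  have h2 : HasDerivAt (meridianRadius A k) (Real.sinh u₀ * meridianSlope A k u₀) (ι (c 0).2) := by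
    rw [hι0]
    exact hasDerivAt_meridianRadius A k u₀
  refine ((HasDerivAt.comp (h := fun t => ι (c t).2) 0 h2 h1).sub hα').congr_deriv ?_
  have := (meridianSlope_pos hA hk u₀).ne'
  -- The slope cancels: the meridian has `ds/dt = sinh u₀`, finite also at the neck.
  field_simp

theorem defining_function_eq_zero (hA : 0 < A) (hk : 0 < k) {ι : ℝ → ℝ}
    (hι0 : ι (meridianHeight A k u₀) = u₀) {x : M × ℝ}
    (hx : x = (F (polar (meridianRadius A k u₀) θ₀), meridianHeight A k u₀)) :
    meridianRadius A k (ι x.2) - ‖F.symm x.1‖ = 0 := by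
  rw [hx, hι0, F.symm_apply_apply, norm_polar, abs_of_pos (meridianRadius_pos hA hk u₀), sub_self]

variable [IsManifold 𝓘(ℝ, Plane) ∞ M]

theorem pointsInto_inside (hA : 0 < A) (hk : 0 < k) {x : M × ℝ}
    (hx : x = (F (polar (meridianRadius A k u₀) θ₀), meridianHeight A k u₀))
    {V : Plane × ℝ} {H : TangentSpace prodModel x}
    (hH : H = ((mfderiv 𝓘(ℝ, Plane) 𝓘(ℝ, Plane) (geodesicPolarChart F θ₀).symm
      (geodesicPolarChart F θ₀ x.1) V.1, V.2) : Plane × ℝ))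
    (hV : 0 < Real.sinh u₀ * V.2 - V.1 0) : PointsInto (inside F A k) x H := by
  intro c hc0 hc hcH
  obtain ⟨ι, hι, hι0, hιr⟩ := exists_localInverse_meridianHeight hA hk u₀
  have hd := hasDerivAt_defining_function u₀ θ₀ hA hk hι hι0 hx hH hc0 hc hcH
  have hz : meridianRadius A k (ι (c 0).2) - ‖F.symm (c 0).1‖ = 0 := by
    rw [hc0]; exact defining_function_eq_zero u₀ θ₀ hA hk hι0 hx
  have hr : ∀ᶠ t in 𝓝 (0 : ℝ), meridianHeight A k (ι (c t).2) = (c t).2 := by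
    have h : Tendsto (fun t => (c t).2) (𝓝 0) (𝓝 (c 0).2) :=
      (continuous_snd.tendsto _).comp hc.continuousAt
    rw [hc0, hx] at h
    exact h.eventually hιr
  filter_upwards [eventually_pos_of_hasDerivAt hd hz hV, nhdsWithin_le_nhds hr] with t h1 h2 u hu
  -- Injectivity of the height makes `ι` of the height the only parameter to be tested.
  rw [hu, (strictMono_meridianHeight hA hk).injective.eq_iff] at h2
  rw [hu, h2] at h1
  linarith

theorem pointsInto_outside (hA : 0 < A) (hk : 0 < k) {x : M × ℝ}
    (hx : x = (F (polar (meridianRadius A k u₀) θ₀), meridianHeight A k u₀))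
    {V : Plane × ℝ} {H : TangentSpace prodModel x}
    (hH : H = ((mfderiv 𝓘(ℝ, Plane) 𝓘(ℝ, Plane) (geodesicPolarChart F θ₀).symm
      (geodesicPolarChart F θ₀ x.1) V.1, V.2) : Plane × ℝ))
    (hV : Real.sinh u₀ * V.2 - V.1 0 < 0) : PointsInto (outside F A k) x H := by
  intro c hc0 hc hcH
  obtain ⟨ι, hι, hι0, hιr⟩ := exists_localInverse_meridianHeight hA hk u₀
  have hd := hasDerivAt_defining_function u₀ θ₀ hA hk hι hι0 hx hH hc0 hc hcH
  have hz : -(meridianRadius A k (ι (c 0).2) - ‖F.symm (c 0).1‖) = 0 := by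
    rw [hc0, defining_function_eq_zero u₀ θ₀ hA hk hι0 hx, neg_zero]
  have hr : ∀ᶠ t in 𝓝 (0 : ℝ), meridianHeight A k (ι (c t).2) = (c t).2 := by
    have h : Tendsto (fun t => (c t).2) (𝓝 0) (𝓝 (c 0).2) :=
      (continuous_snd.tendsto _).comp hc.continuousAt
    rw [hc0, hx] at h
    exact h.eventually hιr
  filter_upwards [eventually_pos_of_hasDerivAt hd.neg hz (neg_pos.2 hV), nhdsWithin_le_nhds hr]
    with t h1 h2
  exact ⟨ι (c t).2, h2.symm, by simp only [Pi.neg_apply] at h1; linarith⟩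

theorem ne_zero_of_transverse (hA : 0 < A) (hk : 0 < k) {x : M × ℝ}
    (hx : x = (F (polar (meridianRadius A k u₀) θ₀), meridianHeight A k u₀))
    {V : Plane × ℝ} {H : TangentSpace prodModel x}
    (hH : H = ((mfderiv 𝓘(ℝ, Plane) 𝓘(ℝ, Plane) (geodesicPolarChart F θ₀).symm
      (geodesicPolarChart F θ₀ x.1) V.1, V.2) : Plane × ℝ))
    (hV : Real.sinh u₀ * V.2 - V.1 0 ≠ 0) : H ≠ 0 := by
  intro h0
  have h1 := hH.symm.trans h0
  have hsrc : x.1 ∈ (geodesicPolarChart F θ₀).source := by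
    rw [hx]
    exact mem_source_of_pos F θ₀ (meridianRadius_pos hA hk u₀)
  have h2 : V.2 = 0 := congrArg (fun z : Plane × ℝ => z.2) h1
  have h3 : V.1 = 0 := by
    have h4 := congrArg (fun z : Plane × ℝ => z.1) h1
    exact ((geodesicPolarChart_mdifferentiable F θ₀).mfderiv hsrc).symm.injective
      (h4.trans (map_zero _).symm)
  exact hV (by simp [h2, h3])

variable [RiemannianBundle (fun x : M => TangentSpace 𝓘(ℝ, Plane) x)]
  [IsContMDiffRiemannianBundle 𝓘(ℝ, Plane) ∞ Plane
    (fun x : M => TangentSpace 𝓘(ℝ, Plane) x)]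

/-- The mean curvature vector of the annulus, in geodesic polar coordinates. -/
theorem exists_hasMeanCurvatureVector (hF : IsGeodesicPolar F) (hA : 0 < A) (hk : 0 < k)
    {x : M × ℝ} (hx : x = (F (polar (meridianRadius A k u₀) θ₀), meridianHeight A k u₀)) :
    ∃ (V : Plane × ℝ) (H : TangentSpace prodModel x),
      HasMeanCurvatureVector (catenoid F A k) x H ∧
      H = ((mfderiv 𝓘(ℝ, Plane) 𝓘(ℝ, Plane) (geodesicPolarChart F θ₀).symm
        (geodesicPolarChart F θ₀ x.1) V.1, V.2) : Plane × ℝ) ∧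
      Real.sinh u₀ * V.2 - V.1 0 = (1 / 2) *
        (fderiv ℝ (fun y => chartMetric (geodesicPolarChart F θ₀) y e₁ e₁)
            (meridianRadius A k u₀ • e₀ + θ₀ • e₁) e₀ /
          (2 * chartMetric (geodesicPolarChart F θ₀) (meridianRadius A k u₀ • e₀ + θ₀ • e₁) e₁ e₁) -
        k * Real.cosh (k * meridianRadius A k u₀) / Real.sinh (k * meridianRadius A k u₀)) := by
  have hpos := meridianRadius_pos hA hk u₀
  have hsrc := mem_source_of_pos F θ₀ hpos
  subst hx
  refine ⟨_, _, ⟨annulus F A k u₀ θ₀, isLocalParametrization_annulus F u₀ θ₀ hA hk,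
    geodesicPolarChart F θ₀, geodesicPolarChart_mem_maximalAtlas F θ₀, hsrc, _, rfl, rfl⟩, rfl, ?_⟩
  have hz0 := meridianSlope_pos hA hk u₀
  have hz' : HasDerivAt (meridianSlope A k) (deriv (meridianSlope A k) u₀) u₀ :=
    ((contDiff_meridianSlope A hk).differentiable (by simp) u₀).hasDerivAt
  have hc := Real.cosh_pos u₀
  have hsq : (Real.sinh u₀ * meridianSlope A k u₀) ^ 2 + meridianSlope A k u₀ ^ 2 =
      (Real.cosh u₀ * meridianSlope A k u₀) ^ 2 := by
    rw [mul_pow, mul_pow, Real.cosh_sq]; ring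
  have ha : (Real.sinh u₀ * meridianSlope A k u₀) ^ 2 + meridianSlope A k u₀ ^ 2 ≠ 0 := by
    rw [hsq]; positivity
  rw [CoordMetric.meanCurvatureVector_congr _ (eventually_chart_annulus F u₀ θ₀ hA hk),
    CoordMetric.meanCurvatureVector_revolution (hasDerivAt_meridianRadius A k)
      (hasDerivAt_meridianHeight A hk) ((Real.hasDerivAt_sinh u₀).mul hz') hz' ha
      (eventually_isPolarFormAt_chartMetric θ₀ hF (by simpa using hpos)), hsq]
  generalize fderiv ℝ (fun y => chartMetric (geodesicPolarChart F θ₀) y e₁ e₁)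
            (meridianRadius A k u₀ • e₀ + θ₀ • e₁) e₀ /
          (2 * chartMetric (geodesicPolarChart F θ₀)
            (meridianRadius A k u₀ • e₀ + θ₀ • e₁) e₁ e₁) = Q
  have hcoth : k * Real.cosh (k * meridianRadius A k u₀) / Real.sinh (k * meridianRadius A k u₀) =
      1 / (meridianSlope A k u₀ * Real.cosh u₀) := by
    rw [sinh_meridianRadius hk, cosh_meridianRadius hk, meridianSlope]
    field_simp
  rw [hcoth]
  generalize meridianSlope A k u₀ = z at hz0 ⊢
  generalize deriv (meridianSlope A k) u₀ = z''
  have hs := Real.sinh_sq u₀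
  generalize Real.sinh u₀ = a at hs ⊢
  generalize Real.cosh u₀ = b at hs hc ⊢
  -- The second derivative of the height cancels, because `s' = sinh u * z'`.
  have h1 : (b * z + a * z'') * z - z'' * (a * z) = b * z ^ 2 := by ring
  rw [h1]
  set E := (1 / 2) * ((b * z) ^ 2)⁻¹ * (b * z ^ 2 / (b * z) ^ 2 - Q * z) with hE
  -- Pairing the normal `(z, -a z)` with the conormal gives `-(a² + 1) z = -b² z`, as `a` and `b`
  -- stand for `sinh u₀` and `cosh u₀`.
  trans -(E * z * b ^ 2)
  · simp only [Prod.smul_fst, Prod.smul_snd, PiLp.smul_apply, smul_eq_mul,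
      PiLp.single_apply, if_true]
    linear_combination -(E * z) * hs
  · rw [hE]
    field_simp
    ring

theorem meanCurvaturePointsInwards_catenoid (hF : IsGeodesicPolar F) (hA : 0 < A) (hk : 0 < k)
    (hK : GaussCurvatureSatisfies M fun κ => κ < -k ^ 2) :
    MeanCurvaturePointsInwards (catenoid F A k) := by
  intro x hxS
  obtain ⟨u, θ, hx⟩ := (mem_catenoid_iff_exists_polar F hA hk).1 hxS
  obtain ⟨V, H, hm, hH, hV⟩ := exists_hasMeanCurvatureVector u θ hF hA hk hx
  have hpos : 0 < Real.sinh u * V.2 - V.1 0 := by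
    rw [hV]
    linarith [lt_logDeriv_of_curvature hk hF hK θ (meridianRadius_pos hA hk u)]
  refine ⟨H, hm, ne_zero_of_transverse u θ hA hk hx hH hpos.ne', fun c h1 h2 h3 => ?_⟩
  filter_upwards [pointsInto_inside u θ hA hk hx hH hpos c h1 h2 h3] with t ht
  exact inside_subset_innerRegion F hA hk ht

theorem meanCurvaturePointsOutwards_catenoid (hF : IsGeodesicPolar F) (hA : 0 < A) (hk : 0 < k)
    (hK : GaussCurvatureSatisfies M fun κ => -k ^ 2 < κ) :
    MeanCurvaturePointsOutwards (catenoid F A k) := by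
  intro x hxS
  obtain ⟨u, θ, hx⟩ := (mem_catenoid_iff_exists_polar F hA hk).1 hxS
  obtain ⟨V, H, hm, hH, hV⟩ := exists_hasMeanCurvatureVector u θ hF hA hk hx
  have hneg : Real.sinh u * V.2 - V.1 0 < 0 := by
    rw [hV]
    linarith [logDeriv_lt_of_curvature hk hF hK θ (meridianRadius_pos hA hk u)]
  refine ⟨H, hm, ne_zero_of_transverse u θ hA hk hx hH hneg.ne, fun c h1 h2 h3 => ?_⟩
  filter_upwards [pointsInto_outside u θ hA hk hx hH hneg c h1 h2 h3] with t ht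
  exact outside_subset_outerRegion F hA hk ht

end

end RiemannianSurface

end

theorem mainTheorem3 {M : Type*} [MetricSpace M]
    [ChartedSpace (EuclideanSpace ℝ (Fin 2)) M]
    [IsManifold 𝓘(ℝ, EuclideanSpace ℝ (Fin 2)) ∞ M]
    [RiemannianBundle (fun x : M => TangentSpace 𝓘(ℝ, EuclideanSpace ℝ (Fin 2)) x)]
    [IsContMDiffRiemannianBundle 𝓘(ℝ, EuclideanSpace ℝ (Fin 2)) ∞ (EuclideanSpace ℝ (Fin 2))
      (fun x : M => TangentSpace 𝓘(ℝ, EuclideanSpace ℝ (Fin 2)) x)]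
    [IsRiemannianManifold 𝓘(ℝ, EuclideanSpace ℝ (Fin 2)) M]
    (hM : RiemannianSurface.IsHadamardSurface M)
    (k₁ k₂ : ℝ) (hk₁ : 0 < k₁) (hk₂ : 0 < k₂)
    (hK : RiemannianSurface.GaussCurvatureSatisfies M (fun κ => -k₁ ^ 2 < κ ∧ κ < -k₂ ^ 2))
    (F : Diffeomorph 𝓘(ℝ, EuclideanSpace ℝ (Fin 2)) 𝓘(ℝ, EuclideanSpace ℝ (Fin 2))
      (EuclideanSpace ℝ (Fin 2)) M ∞)
    (hF : RiemannianSurface.IsGeodesicPolar F)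
    (A : ℝ) (hA : 0 < A) :
    RiemannianSurface.MeanCurvaturePointsOutwards (RiemannianSurface.catenoid F A k₁) ∧
      RiemannianSurface.MeanCurvaturePointsInwards (RiemannianSurface.catenoid F A k₂) :=
  ⟨RiemannianSurface.meanCurvaturePointsOutwards_catenoid hF hA hk₁
      fun φ hφ q hq => (hK φ hφ q hq).1,
    RiemannianSurface.meanCurvaturePointsInwards_catenoid hF hA hk₂
      fun φ hφ q hq => (hK φ hφ q hq).2⟩
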